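/- Let $G$ be a finite-dimensional Lie group, let $X$ be a separable Banach manifold and let $Y$ be a second countable Hilbert manifold, both of class $C^k$ with $k\ge 2$ and without boundary. Let $G$ act on $Y$ by an action $G\times Y\to Y$ of class $C^1$. For $y\in Y$ let $D_y\subset T_yY$ be the image of the differential at $1\in G$ of the map $g\mapsto g\cdot y$ (the tangent space at $y$ to the orbit of $y$), and assume that $\dim D_y$ does not depend on $y\in Y$. Let $A\subset X\times Y$ be an open set such that $(x,g\cdot y)\in A$ for all $(x,y)\in A$ and $g\in G$, and let $f:A\to\mathbb R$ be a function of class $C^k$ such that $f(x,g\cdot y)=f(x,y)$ for all $(x,y)\in A$ and $g\in G$. For $x\in X$ put $A_x=\{y\in Y:(x,y)\in A\}$ and $f_x=f(x,\cdot):A_x\to\mathbb R$. At a critical point $y$ of $f_x$ let $\mathrm H^{f_x}(y)$ be the Hessian of $f_x$, a bounded symmetric bilinear form on $T_yY$, also regarded as a bounded linear map $T_yY\to (T_yY)^*$. The function $f_x$ is called $G$-Morse if, for each of its critical points $y\in A_x$, there is a closed complement $W$ of $D_y$ in $T_yY$ on which $\mathrm H^{f_x}(y)$ is strongly nondegenerate,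 i.e. such that $W\to W^*$, $w\mapsto \mathrm H^{f_x}(y)(w,\cdot)|_W$, is an isomorphism. Assume that for every $(x_0,y_0)\in A$ such that $y_0$ is a critical point of $f_{x_0}$: (a) the Hessian $\mathrm H^{f_{x_0}}(y_0)$ is Fredholm; (b) for every $v\in \mathrm{Ker}\big(\mathrm H^{f_{x_0}}(y_0)\big)\setminus D_{y_0}$ there exists $w\in T_{x_0}X$ such that $$\frac{\partial^2 f}{\partial x\,\partial y}(x_0,y_0)(v,w)\ne 0,$$ where the left-hand side is the derivative at $x_0$, in the direction $w$, of the function $x\mapsto \frac{\partial f}{\partial y}(x,y_0)(v)$. Let $\Pi:X\times Y\to X$ be the projection. Then the set of $x\in\Pi(A)$ such that $f_x:A_x\to\mathbb R$ is a $G$-Morse function is generic in $\Pi(A)$, i.e. it contains the intersection of a countable family of dense open subsets of $\Pi(A)$. -/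

import Mathlib

open scoped Manifold ContDiff Topology

noncomputable section

namespace GMorse

/-! Tangent spaces: for a manifold `Y` modelled on `E`, Mathlib's `TangentSpace 𝓘(ℝ, E) y` is the
space `E`, a vector of `E` standing for the tangent vector at `y` that it represents in the
preferred chart `chartAt E y`. All objects below live on `E` through this identification. -/

section OrbitTangent

variable {EG : Type*} [NormedAddCommGroup EG] [NormedSpace ℝ EG]
  (G : Type*) [TopologicalSpace G] [ChartedSpace EG G] [Group G]
  {E : Type*} [NormedAddCommGroup E] [NormedSpace ℝ E]
  {Y : Type*} [TopologicalSpace Y] [ChartedSpace E Y] [MulAction G Y]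

/-- The differential at `1` of the orbit map `g ↦ g • y`, as a map `𝔤 = T₁G → T_y Y`
(note that `1 • y = y`). -/
def orbitDifferential (y : Y) : EG →L[ℝ] E :=
  mfderiv 𝓘(ℝ, EG) 𝓘(ℝ, E) (fun g : G => g • y) 1

/-- The subspace `D_y` of `T_y Y`: the image of the differential at `1` of `g ↦ g • y`, that is,
the tangent space at `y` to the orbit `G • y`. -/
def orbitTangent (EG : Type*) [NormedAddCommGroup EG] [NormedSpace ℝ EG] [ChartedSpace EG G]
    (y : Y) : Submodule ℝ E :=
  LinearMap.range (orbitDifferential (EG := EG) (E := E) G y).toLinearMap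

end OrbitTangent

section Hessian

variable {E : Type*} [NormedAddCommGroup E] [NormedSpace ℝ E]
  {Y : Type*} [TopologicalSpace Y] [ChartedSpace E Y]

/-- The differential `df(y) : T_y Y → ℝ`. -/
def differential (f : Y → ℝ) (y : Y) : E →L[ℝ] ℝ :=
  mfderiv 𝓘(ℝ, E) 𝓘(ℝ, ℝ) f y

/-- `y` is a critical point of `f`: the differential of `f` at `y` vanishes. -/
def IsCritical (E : Type*) [NormedAddCommGroup E] [NormedSpace ℝ E] [ChartedSpace E Y]
    (f : Y → ℝ) (y : Y) : Prop :=
  differential (E := E) f y = 0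

/-- The Hessian of `f` at a critical point `y`, a symmetric bilinear form on `T_y Y`: the second
derivative, at the image of `y`, of `f` read in the preferred chart at `y`. (At a critical point
this bilinear form on the tangent space does not depend on the chart; it is only used there.) -/
def hessian (f : Y → ℝ) (y : Y) : E →L[ℝ] (E →L[ℝ] ℝ) :=
  fderiv ℝ (fderiv ℝ (fun u : E => f ((chartAt E y).symm u))) (chartAt E y y)

/-- A bounded bilinear form `H` is strongly nondegenerate on the subspace `W`: the map
`W → W*`, `w ↦ H(w, ·)`, is an isomorphism. -/
def StronglyNondegenerateOn (H : E →L[ℝ] (E →L[ℝ] ℝ)) (W : Submodule ℝ E) : Prop :=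
  Function.Bijective (fun w : W => ((H (w : E)).comp W.subtypeL : W →L[ℝ] ℝ))

end Hessian

section Morse

variable {EG : Type*} [NormedAddCommGroup EG] [NormedSpace ℝ EG]
  (G : Type*) [TopologicalSpace G] [ChartedSpace EG G] [Group G]
  {E : Type*} [NormedAddCommGroup E] [NormedSpace ℝ E]
  {Y : Type*} [TopologicalSpace Y] [ChartedSpace E Y] [MulAction G Y]

/-- `f` is `G`-nondegenerate at the critical point `y`: the Hessian of `f` at `y` is strongly
nondegenerate on some closed complement of `D_y`. -/
def IsGNondegenerateAt (EG : Type*) [NormedAddCommGroup EG] [NormedSpace ℝ EG] [ChartedSpace EG G]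
    (E : Type*) [NormedAddCommGroup E] [NormedSpace ℝ E] [ChartedSpace E Y]
    (f : Y → ℝ) (y : Y) : Prop :=
  ∃ W : Submodule ℝ E, IsClosed (W : Set E) ∧ IsCompl (orbitTangent (E := E) G EG y) W ∧
    StronglyNondegenerateOn (hessian f y) W

/-- `f` is a `G`-Morse function on the (open, `G`-invariant) set `U`: it is `G`-nondegenerate at
each of its critical points in `U`. The values of `f` outside the open set `U` play no role. -/
def IsGMorseOn (EG : Type*) [NormedAddCommGroup EG] [NormedSpace ℝ EG] [ChartedSpace EG G]
    (E : Type*) [NormedAddCommGroup E] [NormedSpace ℝ E] [ChartedSpace E Y]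
    (f : Y → ℝ) (U : Set Y) : Prop :=
  ∀ y ∈ U, IsCritical E f y → IsGNondegenerateAt G EG E f y

end Morse

section Mixed

variable {EX : Type*} [NormedAddCommGroup EX] [NormedSpace ℝ EX]
  {X : Type*} [TopologicalSpace X] [ChartedSpace EX X]
  {EY : Type*} [NormedAddCommGroup EY] [NormedSpace ℝ EY]
  {Y : Type*} [TopologicalSpace Y] [ChartedSpace EY Y]

/-- The mixed second derivative `∂²f/∂x∂y (x₀, y₀) (v, w)` for `v ∈ T_{y₀} Y`, `w ∈ T_{x₀} X`:
the derivative at `x₀` in the direction `w` of the real-valued function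
`x ↦ ∂f/∂y (x, y₀) v`. -/
def mixedDerivative (f : X × Y → ℝ) (x₀ : X) (y₀ : Y) (v : EY) (w : EX) : ℝ :=
  differential (E := EX) (fun x : X => differential (E := EY) (fun y : Y => f (x, y)) y₀ v) x₀ w

end Mixed

end GMorse

end

/-
At a critical point `y₀` of `f x₀`, take in a chart the affine slice `y₀ + W`, `W = D_{y₀}ᗮ`. By the
inverse function theorem every orbit near `y₀` meets the slice, and invariance of `f` makes the
Hessians at the points of one orbit congruent. As `D_y ≤ ker H(y)` and `dim D_y` is lower
semicontinuous, a critical point on the slice at which the Hessian is injective on `W` has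
`dim ker H(y) ≤ dim D_{y₀} ≤ dim D_y`, hence `ker H(y) = D_y`, and the Fredholm form `H(y)` is then
strongly nondegenerate on `D_yᗮ`. So `G`-degenerate critical points near `y₀` can be moved to
degenerate zeros of the partial derivative `Φ` along the slice of `f` on `X × W`.

By (a) and (b) `Φ` is a submersion at `(x₀, y₀)` whose partial derivative along `W` is Fredholm of
index `0`. Locally the zeros of `Φ` are then a graph, the parameters of the degenerate ones being
given by the critical values of a family of `C¹` maps between spaces of the same finite dimension.
By Sard's theorem the critical values of each map are null, so the parameters in question form,
locally, a closed set with null fibres, which is nowhere dense; a countable cover of the degenerate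
critical points concludes.
-/

noncomputable section

namespace GMorse

open Set Metric Filter

section NowhereDenseProjection

variable {X X' Y Y' : Type*} [TopologicalSpace X] [TopologicalSpace X'] [TopologicalSpace Y]
  [TopologicalSpace Y']

/-- Near `z`, the projection of `Z ⊆ X × Y` to the parameter space `X` is nowhere dense: the local
form of the statement that `Z` has no point above a generic parameter. -/
def HasNowhereDenseProjAt (Z : Set (X × Y)) (z : X × Y) : Prop :=
  ∃ N ∈ 𝓝 z, IsNowhereDense (Prod.fst '' (Z ∩ N))

theorem isNowhereDense_source_inter_preimage (c : OpenPartialHomeomorph X X') {S : Set X'}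
    (hS : IsNowhereDense S) : IsNowhereDense (c.source ∩ c ⁻¹' S) := by
  rw [isNowhereDense_iff_forall_notMem_nhds] at hS ⊢
  rintro x ⟨hx, hxS⟩ hcl
  refine hS (c x) hxS ?_
  rw [← c.map_nhds_eq hx, mem_map]
  filter_upwards [hcl, c.open_source.mem_nhds hx] with y hy hys
  have hcy := (c.continuousAt hys).continuousWithinAt.mem_closure_image hy
  exact closure_mono (image_subset_iff.2 inter_subset_right) hcy

theorem HasNowhereDenseProjAt.of_eventually {Z : Set (X × Y)} {Z' : Set (X' × Y')} {z : X × Y}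
    (c : OpenPartialHomeomorph X X') (hz : z.1 ∈ c.source) {y' : Y'}
    (hZ' : HasNowhereDenseProjAt Z' (c z.1, y'))
    (h : ∀ N' ∈ 𝓝 (c z.1, y'), ∀ᶠ q in 𝓝 z, q ∈ Z → ∃ u, (c q.1, u) ∈ Z' ∩ N') :
    HasNowhereDenseProjAt Z z := by
  obtain ⟨N', hN', hnd⟩ := hZ'
  have hsource : ∀ᶠ q in 𝓝 z, q.1 ∈ c.source :=
    continuousAt_fst.eventually (c.open_source.mem_nhds hz)
  refine ⟨_, (h N' hN').and hsource, (isNowhereDense_source_inter_preimage c hnd).mono ?_⟩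
  rintro _ ⟨q, ⟨hqZ, hq, hqs⟩, rfl⟩
  obtain ⟨u, hu⟩ := hq hqZ
  exact ⟨hqs, (c q.1, u), hu, rfl⟩

theorem eventually_residual_of_hasNowhereDenseProjAt [SecondCountableTopology Y] {W : Set X}
    [SecondCountableTopology W] {Z : Set (X × Y)} (hZ : ∀ z ∈ Z, HasNowhereDenseProjAt Z z) :
    ∀ᶠ x in residual X, x ∈ W → ∀ y, (x, y) ∉ Z := by
  choose! N hN hnd using hZ
  let ι : W × Y → X × Y := Prod.map (↑) id
  have hι : Continuous ι := continuous_subtype_val.prodMap continuous_id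
  obtain ⟨t, htZ, htc, hcover⟩ := TopologicalSpace.countable_cover_nhdsWithin (s := ι ⁻¹' Z)
    (f := fun z => ι ⁻¹' N (ι z)) fun z hz =>
      mem_nhdsWithin_of_mem_nhds (hι.continuousAt.preimage_mem_nhds (hN _ hz))
  have hmeagre : ∀ᶠ x in residual X, ∀ z ∈ t, x ∈ (Prod.fst '' (Z ∩ N (ι z)))ᶜ :=
    (eventually_countable_ball htc).2 fun z hz => (hnd _ (htZ hz)).isMeagre
  filter_upwards [hmeagre] with x hx hxW y hxy
  obtain ⟨z, hz, hzN⟩ := mem_iUnion₂.1 (hcover (show (⟨x, hxW⟩, y) ∈ ι ⁻¹' Z from hxy))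
  exact hx z hz ⟨(x, y), ⟨hxy, hzN⟩, rfl⟩

end NowhereDenseProjection

theorem secondCountableTopology_model (E X : Type*) [NormedAddCommGroup E] [NormedSpace ℝ E]
    [TopologicalSpace X] [ChartedSpace E X] [TopologicalSpace.SeparableSpace X] [Nonempty X] :
    SecondCountableTopology E := by
  obtain ⟨x⟩ := ‹Nonempty X›
  let c := chartAt E x
  have := c.open_source.isOpenEmbedding_subtypeVal.separableSpace
  have : TopologicalSpace.SeparableSpace c.target :=
    c.toHomeomorphSourceTarget.surjective.denseRange.separableSpace
      c.toHomeomorphSourceTarget.continuous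
  have htarget := TopologicalSpace.IsSeparable.of_subtype c.target
  have hspan : Submodule.span ℝ c.target = ⊤ :=
    Submodule.eq_top_of_nonempty_interior' _
      ⟨c x, interior_mono Submodule.subset_span
        (c.open_target.interior_eq.symm ▸ mem_chart_target E x)⟩
  have hsep := htarget.span (R := ℝ)
  rw [hspan, Submodule.top_coe, TopologicalSpace.isSeparable_univ_iff] at hsep
  exact UniformSpace.secondCountable_of_separable E

theorem eventually_residual_forall_notMem (E : Type*) {X Y : Type*} [NormedAddCommGroup E]
    [NormedSpace ℝ E] [TopologicalSpace X] [ChartedSpace E X] [TopologicalSpace.SeparableSpace X]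
    [TopologicalSpace Y] [SecondCountableTopology Y] {Z : Set (X × Y)}
    (hZ : ∀ z ∈ Z, HasNowhereDenseProjAt Z z) :
    ∀ᶠ x in residual X, ∀ y, (x, y) ∉ Z := by
  rcases isEmpty_or_nonempty X with hX | hX
  · exact Eventually.of_forall fun x => hX.elim x
  have := secondCountableTopology_model E X
  obtain ⟨s, hs, hd⟩ := TopologicalSpace.exists_countable_dense X
  have hcharts : ∀ᶠ x in residual X, ∀ d ∈ s, x ∈ (chartAt E d).source → ∀ y, (x, y) ∉ Z :=
    (eventually_countable_ball hs).2 fun d _ =>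
      have := (chartAt E d).secondCountableTopology_source
      eventually_residual_of_hasNowhereDenseProjAt hZ
  have hcover : ∀ᶠ x in residual X, ∃ d ∈ s, x ∈ (chartAt E d).source := by
    have hdense : (⋃ d ∈ s, (chartAt E d).source) ∈ residual X :=
      residual_of_dense_open (isOpen_biUnion fun d _ => (chartAt E d).open_source)
        (hd.mono fun d hds => mem_iUnion₂.2 ⟨d, hds, mem_chart_source E d⟩)
    filter_upwards [hdense] with x hx using by simpa using hx
  filter_upwards [hcharts, hcover] with x hx ⟨d, hds, hxd⟩ using hx d hds hxd

section PartialDerivative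

variable {P M N : Type*} [NormedAddCommGroup P] [NormedSpace ℝ P] [NormedAddCommGroup M]
  [NormedSpace ℝ M] [NormedAddCommGroup N] [NormedSpace ℝ N]

/-- The partial derivative of `F` with respect to its second variable. -/
def fderivRight (F : P × M → N) (q : P × M) : M →L[ℝ] N :=
  fderiv ℝ (fun m => F (q.1, m)) q.2

variable {F : P × M → N} {q : P × M}

theorem hasFDerivAt_fderivRight (hF : DifferentiableAt ℝ F q) :
    HasFDerivAt (fun m => F (q.1, m)) (fderivRight F q) q.2 :=
  (hF.comp q.2 (hasFDerivAt_prodMk_right q.1 q.2).differentiableAt).hasFDerivAt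

theorem fderivRight_eq (hF : DifferentiableAt ℝ F q) :
    fderivRight F q = (fderiv ℝ F q).comp (.inr ℝ P M) :=
  (hasFDerivAt_fderivRight hF).unique
    (hF.hasFDerivAt.comp q.2 (hasFDerivAt_prodMk_right q.1 q.2))

theorem fderiv_apply_zero_left (hF : DifferentiableAt ℝ F q) (m : M) :
    fderiv ℝ F q (0, m) = fderivRight F q m := by
  rw [fderivRight_eq hF]
  rfl

theorem contDiffAt_fderivRight {n : WithTop ℕ∞} (hF : ContDiffAt ℝ (n + 1) F q) :
    ContDiffAt ℝ n (fderivRight F) q := by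
  refine ((hF.fderiv_right le_rfl).clm_comp contDiffAt_const).congr_of_eventuallyEq
    (f := fun q => (fderiv ℝ F q).comp (.inr ℝ P M)) ?_
  filter_upwards [(hF.of_le le_add_self).eventually (by simp)] with r hr
  exact fderivRight_eq (hr.differentiableAt one_ne_zero)

end PartialDerivative

section Sard

variable {Z K : Type*} [NormedAddCommGroup Z] [NormedSpace ℝ Z] [NormedAddCommGroup K]
  [NormedSpace ℝ K]

theorem isClosed_image_fst_of_isCompact {X Y V : Type*} [TopologicalSpace X] [TopologicalSpace Y]
    [TopologicalSpace V] {B : Set X} (hB : IsClosed B) {C : Set Y} (hC : IsCompact C)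
    {h : X × Y → V} (hh : ∀ z ∈ B ×ˢ C, ContinuousAt h z) {T : Set V} (hT : IsClosed T) :
    IsClosed {x | x ∈ B ∧ ∃ y ∈ C, h (x, y) ∈ T} := by
  have := isCompact_iff_compactSpace.1 hC
  let j : X × C → X × Y := Prod.map id (↑)
  have hj : Continuous j := continuous_id.prodMap continuous_subtype_val
  have hcont : ContinuousOn (h ∘ j) (Prod.fst ⁻¹' B) := fun z hz =>
    ((hh (j z) ⟨hz, z.2.2⟩).comp hj.continuousAt).continuousWithinAt
  have hclosed := hcont.preimage_isClosed_of_isClosed (hB.preimage continuous_fst) hT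
  convert isClosedMap_fst_of_compactSpace _ hclosed using 1
  ext x
  simp [j]

theorem measure_image_det_fderiv_eq_zero [FiniteDimensional ℝ K] [MeasurableSpace K] [BorelSpace K]
    (μ : MeasureTheory.Measure K) [μ.IsAddHaarMeasure] {s : Set K} {τ : K → K}
    (hτ : ∀ a ∈ s, DifferentiableAt ℝ τ a) :
    μ (τ '' {a ∈ s | (fderiv ℝ τ a).det = 0}) = 0 :=
  MeasureTheory.addHaar_image_eq_zero_of_det_fderivWithin_eq_zero μ
    (fun a ha => (hτ a ha.1).hasFDerivAt.hasFDerivWithinAt) fun _ ha => ha.2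

variable {τ : Z × K → K}

theorem isClosed_criticalValues {B : Set Z} (hB : IsClosed B) {C : Set K} (hC : IsCompact C)
    (hτ : ∀ q ∈ B ×ˢ C, ContDiffAt ℝ 1 τ q) :
    IsClosed {x : Z × K | x.1 ∈ B ∧
      ∃ a ∈ C, τ (x.1, a) = x.2 ∧ (fderivRight τ (x.1, a)).det = 0} := by
  let h : (Z × K) × K → K × ℝ := fun q =>
    (τ (q.1.1, q.2) - q.1.2, (fderivRight τ (q.1.1, q.2)).det)
  have hh : ∀ q ∈ (Prod.fst ⁻¹' B) ×ˢ C, ContinuousAt h q := by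
    rintro ⟨⟨z, t⟩, a⟩ ⟨hz, ha⟩
    have hza : ContDiffAt ℝ 1 τ (z, a) := hτ _ ⟨hz, ha⟩
    have hD : ContinuousAt (fderivRight τ) (z, a) :=
      (contDiffAt_fderivRight (n := 0) (by simpa using hza)).continuousAt
    let ι : (Z × K) × K → Z × K := fun q => (q.1.1, q.2)
    have hι : ContinuousAt ι ((z, t), a) := by fun_prop
    refine ((hza.continuousAt.comp' (f := ι) hι).sub (by fun_prop)).prodMk ?_
    exact ContinuousLinearMap.continuous_det.continuousAt.comp' (hD.comp' (f := ι) hι)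
  simpa only [h, mem_preimage, mem_singleton_iff, Prod.mk_eq_zero, sub_eq_zero] using
    isClosed_image_fst_of_isCompact (hB.preimage continuous_fst) hC hh
      (isClosed_singleton (x := (0 : K × ℝ)))

theorem isNowhereDense_criticalValues [FiniteDimensional ℝ K] {B : Set Z} (hB : IsClosed B)
    {C : Set K} (hC : IsCompact C) (hτ : ∀ q ∈ B ×ˢ C, ContDiffAt ℝ 1 τ q) :
    IsNowhereDense {x : Z × K | x.1 ∈ B ∧
      ∃ a ∈ C, τ (x.1, a) = x.2 ∧ (fderivRight τ (x.1, a)).det = 0} := by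
  -- At an interior point `(z, t)` the critical values of `τ (z, ·)` would fill a ball around `t`.
  rw [(isClosed_criticalValues hB hC hτ).isNowhereDense_iff, eq_empty_iff_forall_notMem]
  rintro ⟨z, t⟩ hzt
  borelize K
  let μ : MeasureTheory.Measure K := .addHaar
  have hz : z ∈ B := (interior_subset hzt).1
  let S : Set K := (fun a => τ (z, a)) '' {a ∈ C | (fderivRight τ (z, a)).det = 0}
  have hnull : μ S = 0 := measure_image_det_fderiv_eq_zero μ fun a ha =>
    (hasFDerivAt_fderivRight ((hτ (z, a) ⟨hz, ha⟩).differentiableAt one_ne_zero)).differentiableAt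
  have hnhds : S ∈ 𝓝 t := by
    filter_upwards [(Continuous.prodMk_right z).continuousAt.preimage_mem_nhds
      (mem_interior_iff_mem_nhds.1 hzt)] with s hs
    obtain ⟨-, a, ha, hτa, hdet⟩ := hs
    exact ⟨a, ⟨ha, hdet⟩, hτa⟩
  exact (MeasureTheory.Measure.measure_pos_of_mem_nhds μ hnhds).ne' hnull

theorem hasNowhereDenseProjAt_criticalValues [FiniteDimensional ℝ K] {z₀ : Z} {a₀ : K}
    (hτ : ContDiffAt ℝ 1 τ (z₀, a₀)) (t₀ : K) :
    HasNowhereDenseProjAt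
      {q : (Z × K) × K | τ (q.1.1, q.2) = q.1.2 ∧ (fderivRight τ (q.1.1, q.2)).det = 0}
      ((z₀, t₀), a₀) := by
  obtain ⟨r, hr, hball⟩ := nhds_basis_closedBall.mem_iff.1 (hτ.eventually (by simp))
  rw [← closedBall_prod_same] at hball
  refine ⟨(closedBall z₀ r ×ˢ univ) ×ˢ closedBall a₀ r,
    prod_mem_nhds (prod_mem_nhds (closedBall_mem_nhds z₀ hr) univ_mem) (closedBall_mem_nhds a₀ hr),
    (isNowhereDense_criticalValues isClosed_closedBall (isCompact_closedBall a₀ r) hball).mono ?_⟩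
  rintro _ ⟨⟨x, a⟩, ⟨⟨hτa, hdet⟩, ⟨hx, -⟩, ha⟩, rfl⟩
  exact ⟨hx, a, ha, hτa, hdet⟩

end Sard

section ParametricTransversality

theorem exists_parametrization_of_zeros {V N Q : Type*} [NormedAddCommGroup V] [NormedSpace ℝ V]
    [CompleteSpace V] [NormedAddCommGroup N] [NormedSpace ℝ N] [CompleteSpace N]
    [NormedAddCommGroup Q] [NormedSpace ℝ Q] [CompleteSpace Q] {Φ : V → N} {q₀ : V}
    (hΦ : ContDiffAt ℝ 1 Φ q₀) (hΦ₀ : Φ q₀ = 0) {R : V →L[ℝ] Q}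
    (hR : Function.Bijective ((fderiv ℝ Φ q₀).prod R)) :
    ∃ σ : Q → V, ContDiffAt ℝ 1 σ (R q₀) ∧ ∀ᶠ q in 𝓝 q₀, Φ q = 0 →
      σ (R q) = q ∧ ∀ v, fderiv ℝ Φ q v = 0 → fderiv ℝ σ (R q) (R v) = v := by
  let Θ : V → N × Q := fun q => (Φ q, R q)
  have hΘ : ContDiffAt ℝ 1 Θ q₀ := hΦ.prodMk R.contDiff.contDiffAt
  have hΘ' : ∀ q, ContDiffAt ℝ 1 Φ q → HasFDerivAt Θ ((fderiv ℝ Φ q).prod R) q := fun q hq =>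
    (hq.differentiableAt one_ne_zero).hasFDerivAt.prodMk R.hasFDerivAt
  let E : V ≃L[ℝ] N × Q := .ofBijective ((fderiv ℝ Φ q₀).prod R)
    (LinearMap.ker_eq_bot.2 hR.1) (LinearMap.range_eq_top.2 hR.2)
  have hE : HasFDerivAt Θ (E : V →L[ℝ] N × Q) q₀ := hΘ' q₀ hΦ
  let ψ := hΘ.localInverse hE one_ne_zero
  have hψ : ContDiffAt ℝ 1 ψ (Θ q₀) := hΘ.to_localInverse hE one_ne_zero
  have hψΘ : ∀ᶠ q in 𝓝 q₀, ψ (Θ q) = q :=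
    (hΘ.hasStrictFDerivAt' hE one_ne_zero).eventually_left_inverse
  let j : Q →L[ℝ] N × Q := .inr ℝ N Q
  have hj : ∀ q, Φ q = 0 → j (R q) = Θ q := fun q hq => Prod.ext hq.symm rfl
  refine ⟨ψ ∘ j, ?_, ?_⟩
  · exact ContDiffAt.comp _ (by rwa [hj q₀ hΦ₀]) j.contDiff.contDiffAt
  filter_upwards [hψΘ, hψΘ.eventually_nhds, hΦ.eventually (by simp),
    hΘ.continuousAt.eventually (hψ.eventually (by simp))] with q hq hqn hΦq hψq hq0
  have hψ' := (hψq.differentiableAt one_ne_zero).hasFDerivAt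
  refine ⟨by rwa [Function.comp_apply, hj q hq0], fun v hv => ?_⟩
  have hleft : (fderiv ℝ ψ (Θ q)).comp ((fderiv ℝ Φ q).prod R) = .id ℝ V :=
    (hψ'.comp q (hΘ' q hΦq)).unique ((hasFDerivAt_id q).congr_of_eventuallyEq hqn)
  have hσ : fderiv ℝ (ψ ∘ j) (R q) = (fderiv ℝ ψ (Θ q)).comp j :=
    (HasFDerivAt.comp (R q) (by rwa [hj q hq0]) j.hasFDerivAt).fderiv
  calc fderiv ℝ (ψ ∘ j) (R q) (R v)
      = (fderiv ℝ ψ (Θ q)).comp ((fderiv ℝ Φ q).prod R) v := by rw [hσ]; simp [j, hv]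
    _ = v := by rw [hleft]; rfl

theorem surjective_comp_inl {P M N K : Type*} [AddCommGroup P] [Module ℝ P] [TopologicalSpace P]
    [AddCommGroup M] [Module ℝ M] [TopologicalSpace M] [AddCommGroup N] [Module ℝ N]
    [TopologicalSpace N] [AddCommGroup K] [Module ℝ K] [TopologicalSpace K] {A : P × M →L[ℝ] N}
    {ρ : N →L[ℝ] K} (hρ : Function.Surjective ρ) (hA : Function.Surjective A)
    (hAρ : (A.comp (.inr ℝ P M)).range ≤ ρ.ker) :
    Function.Surjective ((ρ.comp A).comp (.inl ℝ P M)) := by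
  intro k
  obtain ⟨n, rfl⟩ := hρ k
  obtain ⟨⟨p, m⟩, rfl⟩ := hA n
  have hm : ρ (A (0, m)) = 0 := hAρ ⟨m, rfl⟩
  refine ⟨p, ?_⟩
  calc ρ (A (p, 0)) = ρ (A (p, 0)) + ρ (A (0, m)) := by rw [hm, add_zero]
    _ = ρ (A (p, m)) := by simp [← map_add]

theorem bijective_prod_prodMap {P M N Z K : Type*} [NormedAddCommGroup P] [NormedSpace ℝ P]
    [NormedAddCommGroup M] [NormedSpace ℝ M] [NormedAddCommGroup N] [NormedSpace ℝ N]
    [NormedAddCommGroup Z] [NormedSpace ℝ Z] [NormedAddCommGroup K] [NormedSpace ℝ K]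
    {A : P × M →L[ℝ] N} {ρ : N →L[ℝ] K} (hρ : ρ.ker = (A.comp (.inr ℝ P M)).range)
    (e : P ≃L[ℝ] Z × K) (he : ∀ p, (e p).2 = ρ (A (p, 0))) {κ : M →L[ℝ] K}
    (hκ : ∀ a, ∃! m, A (0, m) = 0 ∧ κ m = a) :
    Function.Bijective
      (A.prod (((ContinuousLinearMap.fst ℝ Z K).comp (e : P →L[ℝ] Z × K)).prodMap κ)) := by
  have hA : ∀ p m, A (p, m) = A (p, 0) + A (0, m) := fun p m => by simp [← map_add]
  have hρA : ∀ n, ρ n = 0 ↔ ∃ m, A (0, m) = n := fun n => SetLike.ext_iff.1 hρ n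
  constructor
  · rw [injective_iff_map_eq_zero]
    rintro ⟨p, m⟩ h
    obtain ⟨hpm, hep, hm⟩ : A (p, m) = 0 ∧ (e p).1 = 0 ∧ κ m = 0 := by simpa using h
    have hρp : ρ (A (p, 0)) = 0 := by
      rw [hρA]
      exact ⟨-m, by rw [← sub_eq_zero, ← map_sub, ← neg_eq_zero, ← map_neg]; simpa using hpm⟩
    have hp : p = 0 := e.map_eq_zero_iff.1 (Prod.ext hep ((he p).trans hρp))
    subst hp
    rw [(hκ 0).unique ⟨hpm, hm⟩ ⟨map_zero A, map_zero κ⟩, Prod.mk_zero_zero]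
  · rintro ⟨n, z, a⟩
    let p := e.symm (z, ρ n)
    have hp : e p = (z, ρ n) := e.apply_symm_apply _
    obtain ⟨m, hm⟩ : ∃ m, A (0, m) = n - A (p, 0) := by
      rw [← hρA, map_sub, ← he, hp, sub_self]
    obtain ⟨m', ⟨hm', hκm'⟩, -⟩ := hκ (a - κ m)
    have hAm : A (0, m + m') = n - A (p, 0) := by
      rw [← hm, ← add_zero (A (0, m)), ← hm', ← map_add]
      simp
    refine ⟨(p, m + m'), Prod.ext ?_ (Prod.ext ?_ ?_)⟩
    · change A (p, m + m') = n
      rw [hA, hAm, add_sub_cancel]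
    · change (e p).1 = z
      rw [hp]
    · change κ (m + m') = a
      rw [map_add, hκm', add_sub_cancel]

variable {P M N : Type*} [NormedAddCommGroup P] [NormedSpace ℝ P] [CompleteSpace P]
  [NormedAddCommGroup M] [NormedSpace ℝ M] [CompleteSpace M] [NormedAddCommGroup N]
  [NormedSpace ℝ N] [CompleteSpace N] {Φ : P × M → N} {q₀ : P × M}

theorem hasNowhereDenseProjAt_degenerateZeros_of_bijective {Z K : Type*} [NormedAddCommGroup Z]
    [NormedSpace ℝ Z] [CompleteSpace Z] [NormedAddCommGroup K] [NormedSpace ℝ K]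
    [FiniteDimensional ℝ K] (hΦ : ContDiffAt ℝ 1 Φ q₀) (hΦ₀ : Φ q₀ = 0) (e : P ≃L[ℝ] Z × K)
    (κ : M →L[ℝ] K)
    (hbij : Function.Bijective ((fderiv ℝ Φ q₀).prod
      (((ContinuousLinearMap.fst ℝ Z K).comp (e : P →L[ℝ] Z × K)).prodMap κ))) :
    HasNowhereDenseProjAt {q | Φ q = 0 ∧ ¬ Function.Injective (fderivRight Φ q)} q₀ := by
  have := FiniteDimensional.complete ℝ K
  -- Near `q₀` the zeros `(p, m)` of `Φ` are the solutions of `e p = (z, τ (z, a))`, `a = κ m`.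
  obtain ⟨σ, hσ, hzeros⟩ := exists_parametrization_of_zeros hΦ hΦ₀ hbij
  let R : P × M →L[ℝ] Z × K :=
    ((ContinuousLinearMap.fst ℝ Z K).comp (e : P →L[ℝ] Z × K)).prodMap κ
  let pr : P × M →L[ℝ] K :=
    (ContinuousLinearMap.snd ℝ Z K).comp ((e : P →L[ℝ] Z × K).comp (.fst ℝ P M))
  let τ : Z × K → K := pr ∘ σ
  have hτ : ContDiffAt ℝ 1 τ (R q₀) := pr.contDiff.contDiffAt.comp _ hσ
  refine (hasNowhereDenseProjAt_criticalValues hτ (e q₀.1).2).of_eventually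
    e.toHomeomorph.toOpenPartialHomeomorph (mem_univ _) fun N' hN' => ?_
  have hcont : Continuous fun q : P × M => (e q.1, κ q.2) := by fun_prop
  filter_upwards [hcont.continuousAt.preimage_mem_nhds hN', hzeros,
    R.continuous.continuousAt.eventually (hσ.eventually (by simp)),
    hΦ.eventually (by simp)] with q hqN hq hσq hΦq ⟨hq0, hninj⟩
  obtain ⟨hσR, hσ'⟩ := hq hq0
  refine ⟨κ q.2, ⟨congrArg pr hσR, ?_⟩, hqN⟩
  obtain ⟨v, hv, hv0⟩ : ∃ v, fderivRight Φ q v = 0 ∧ v ≠ 0 := by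
    simpa [injective_iff_map_eq_zero] using hninj
  have hRv : fderiv ℝ σ (R q) (0, κ v) = (0, v) := by
    rw [← hσ' (0, v) (by rw [fderiv_apply_zero_left (hΦq.differentiableAt one_ne_zero), hv])]
    simp [R]
  have hσd := hσq.differentiableAt one_ne_zero
  have hτd : HasFDerivAt τ (pr.comp (fderiv ℝ σ (R q))) (R q) :=
    pr.hasFDerivAt.comp _ hσd.hasFDerivAt
  have hτv : fderivRight τ (R q) (κ v) = 0 := by
    rw [← fderiv_apply_zero_left hτd.differentiableAt, hτd.fderiv, ContinuousLinearMap.comp_apply,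
      hRv]
    simp [pr]
  have hκv : κ v ≠ 0 := by
    intro h
    rw [h, ← Prod.zero_eq_mk, map_zero] at hRv
    exact hv0 (congrArg Prod.snd hRv).symm
  exact LinearMap.det_eq_zero_iff_ker_ne_bot.2 fun h => hκv (LinearMap.ker_eq_bot'.1 h _ hτv)

theorem hasNowhereDenseProjAt_degenerateZeros (hΦ : ContDiffAt ℝ 1 Φ q₀) (hΦ₀ : Φ q₀ = 0)
    (hsurj : Function.Surjective (fderiv ℝ Φ q₀)) (hT : (fderivRight Φ q₀).IsFredholm)
    (hindex : Module.finrank ℝ (fderivRight Φ q₀).ker =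
      Module.finrank ℝ (N ⧸ (fderivRight Φ q₀).range)) :
    HasNowhereDenseProjAt {q | Φ q = 0 ∧ ¬ Function.Injective (fderivRight Φ q)} q₀ := by
  set T := fderivRight Φ q₀ with hTdef
  have hA : fderivRight Φ q₀ = (fderiv ℝ Φ q₀).comp (.inr ℝ P M) :=
    fderivRight_eq (hΦ.differentiableAt one_ne_zero)
  have : FiniteDimensional ℝ T.ker := hT.finite_ker
  have : FiniteDimensional ℝ (N ⧸ T.range) := hT.finite_coker
  have := hT.isClosed_range
  obtain ⟨κ, hκ⟩ := hT.closedComplemented_ker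
  obtain ⟨E⟩ := FiniteDimensional.nonempty_continuousLinearEquiv_of_finrank_eq hindex.symm
  let ρ : N →L[ℝ] T.ker := (E : _ →L[ℝ] T.ker).comp T.range.mkQL
  have hρ : ρ.ker = T.range := by ext n; simp [ρ]
  let π : P →L[ℝ] T.ker := (ρ.comp (fderiv ℝ Φ q₀)).comp (.inl ℝ P M)
  have hπ : Function.Surjective π := surjective_comp_inl
    (E.surjective.comp T.range.mkQ_surjective) hsurj (by rw [hρ, hTdef, hA])
  obtain ⟨ι, hι⟩ := π.exists_rightInverse_of_surjective (LinearMap.range_eq_top.2 hπ)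
  have := π.isClosed_ker.completeSpace_coe
  let e : P ≃L[ℝ] π.ker × T.ker :=
    (ContinuousLinearEquiv.equivOfRightInverse π ι (DFunLike.congr_fun hι)).trans
      (.prodComm ℝ _ _)
  refine hasNowhereDenseProjAt_degenerateZeros_of_bijective hΦ hΦ₀ e κ
    (bijective_prod_prodMap (ρ := ρ) (by rw [hρ, hTdef, hA]) e (fun p => rfl) fun a => ?_)
  simp only [fderiv_apply_zero_left (hΦ.differentiableAt one_ne_zero)]
  refine ⟨a, ⟨a.2, hκ a⟩, fun m hm => ?_⟩
  rw [← hm.2]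
  exact (congrArg Subtype.val (hκ ⟨m, hm.1⟩)).symm

end ParametricTransversality

section SymmetricForm

section Retract

open LinearMap.FiniteRangeSetoid

theorem isFredholm_of_retract {V N V' N' : Type*} [NormedAddCommGroup V] [NormedSpace ℝ V]
    [NormedAddCommGroup N] [NormedSpace ℝ N] [NormedAddCommGroup V'] [NormedSpace ℝ V']
    [NormedAddCommGroup N'] [NormedSpace ℝ N'] {T : V →L[ℝ] N} {T' : V' →L[ℝ] N'}
    (ι : V' →L[ℝ] V) (π : V →L[ℝ] V') (j : N' →L[ℝ] N) (r : N →L[ℝ] N') (hπι : ∀ v, π (ι v) = v)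
    (hrj : ∀ n, r (j n) = n) (hj : ∀ v, j (T' v) = T (ι v)) (hr : ∀ v, T' (π v) = r (T v))
    (hT : T.IsFredholm) : T'.IsFredholm := by
  obtain ⟨S, hTS, hST⟩ := hT.exists_isQuasiInverse
  refine .of_isQuasiInverse (v := π.comp (S.comp j)) ⟨?_, ?_⟩
  · have h := equiv_comp_left (u' := π.toLinearMap)
      (equiv_comp_right (u := ι.toLinearMap) hTS)
    change (_ : V' →ₗ[ℝ] V') ≈ _
    convert h using 1
    · ext v; simp [hj]
    · ext v; simp [hπι]
  · have h := equiv_comp_left (u' := r.toLinearMap)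
      (equiv_comp_right (u := j.toLinearMap) hST)
    change (_ : N' →ₗ[ℝ] N') ≈ _
    convert h using 1
    · ext n; simp [hr]
    · ext n; simp [hrj]

end Retract

/-- The restriction to the subspace `W` of the bilinear form `B`. -/
def restrictForm {H : Type*} [NormedAddCommGroup H] [NormedSpace ℝ H] (B : H →L[ℝ] H →L[ℝ] ℝ)
    (W : Submodule ℝ H) : W →L[ℝ] W →L[ℝ] ℝ :=
  B.bilinearComp W.subtypeL W.subtypeL

variable {H : Type*} [NormedAddCommGroup H] [InnerProductSpace ℝ H]
  {B : H →L[ℝ] H →L[ℝ] ℝ} {D : Submodule ℝ H} [D.HasOrthogonalProjection]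

theorem apply_orthogonalProjectionOnto {N : Type*} [NormedAddCommGroup N] [NormedSpace ℝ N]
    {T : H →L[ℝ] N} (hD : D ≤ T.ker) (v : H) : T (Dᗮ.orthogonalProjectionOnto v) = T v := by
  have hv : v - Dᗮ.orthogonalProjectionOnto v ∈ D := by
    have h := Dᗮ.sub_starProjection_mem_orthogonal v
    rwa [Submodule.orthogonal_orthogonal] at h
  exact (sub_eq_zero.1 ((map_sub T _ _).symm.trans (hD hv))).symm

theorem apply_apply_orthogonalProjectionOnto (hB : ∀ v w, B v w = B w v) (hD : D ≤ B.ker)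
    (v w : H) : B v (Dᗮ.orthogonalProjectionOnto w) = B v w :=
  apply_orthogonalProjectionOnto (fun d hd => (hB v d).trans (DFunLike.congr_fun (hD hd) v)) w

theorem apply_eq_zero_of_restrictForm_orthogonal (hB : ∀ v w, B v w = B w v) (hD : D ≤ B.ker)
    {v : Dᗮ} (hv : restrictForm B Dᗮ v = 0) : B v = 0 :=
  ContinuousLinearMap.ext fun w =>
    (apply_apply_orthogonalProjectionOnto hB hD v w).symm.trans (DFunLike.congr_fun hv _)

theorem finrank_ker_le_of_restrictForm [FiniteDimensional ℝ D] {B' : H →L[ℝ] H →L[ℝ] ℝ}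
    (e : H ≃L[ℝ] H) (hB' : ∀ v w, B' v w = B (e v) (e w))
    (hinj : Function.Injective (restrictForm B Dᗮ)) :
    Module.finrank ℝ B'.ker ≤ Module.finrank ℝ D := by
  let T : B'.ker →L[ℝ] D :=
    D.orthogonalProjectionOnto.comp ((e : H →L[ℝ] H).comp B'.ker.subtypeL)
  refine LinearMap.finrank_le_finrank_of_injective (f := T.toLinearMap) ?_
  refine (injective_iff_map_eq_zero _).2 fun v hTv => ?_
  have hev : e v ∈ Dᗮ := Submodule.orthogonalProjectionOnto_eq_zero_iff.1 hTv
  have hker : restrictForm B Dᗮ ⟨e v, hev⟩ = 0 := ContinuousLinearMap.ext fun w => by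
    obtain ⟨w', hw'⟩ := e.surjective w
    calc B (e v) w = B' v w' := by rw [hB', hw']
      _ = 0 := DFunLike.congr_fun v.2 w'
  have hev0 : e v = 0 := congrArg Subtype.val (hinj (hker.trans (map_zero _).symm))
  exact Subtype.ext (e.map_eq_zero_iff.1 hev0)

theorem isFredholm_restrictForm_orthogonal (hB : ∀ v w, B v w = B w v) (hD : D ≤ B.ker)
    (hFred : B.IsFredholm) : (restrictForm B Dᗮ).IsFredholm := by
  let π : H →L[ℝ] Dᗮ := Dᗮ.orthogonalProjectionOnto
  let j : (Dᗮ →L[ℝ] ℝ) →L[ℝ] H →L[ℝ] ℝ := π.precomp ℝ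
  let r : (H →L[ℝ] ℝ) →L[ℝ] Dᗮ →L[ℝ] ℝ := Dᗮ.subtypeL.precomp ℝ
  refine isFredholm_of_retract (N := H →L[ℝ] ℝ) (N' := Dᗮ →L[ℝ] ℝ) Dᗮ.subtypeL π j r
    (fun v => Submodule.orthogonalProjectionOnto_mem_subspace_eq_self v) (fun l => ?_) (fun v => ?_)
    (fun v => ?_) hFred
  · ext w
    exact congrArg l (Submodule.orthogonalProjectionOnto_mem_subspace_eq_self w)
  · ext w
    exact apply_apply_orthogonalProjectionOnto hB hD v w
  · ext w
    exact DFunLike.congr_fun (apply_orthogonalProjectionOnto hD v) (w : H)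

variable [CompleteSpace H]

theorem mem_range_iff_forall_ker (hB : ∀ v w, B v w = B w v)
    (hclosed : IsClosed (B.range : Set (H →L[ℝ] ℝ))) {l : H →L[ℝ] ℝ} :
    l ∈ B.range ↔ ∀ v, B v = 0 → l v = 0 := by
  refine ⟨?_, fun hl => ?_⟩
  · rintro ⟨w, rfl⟩ v hv
    exact (hB w v).trans (DFunLike.congr_fun hv w)
  · let J := InnerProductSpace.toDual ℝ H
    have hJ : ∀ l v, inner ℝ (J.symm l) v = l v := fun _ _ => InnerProductSpace.toDual_symm_apply
    let S : Submodule ℝ H := B.range.comap J.toLinearEquiv.toLinearMap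
    have hS : ∀ l, J.symm l ∈ S ↔ l ∈ B.range := fun l => by simp [S]
    have : CompleteSpace S := (hclosed.preimage J.continuous).completeSpace_coe
    rw [← hS, ← S.orthogonal_orthogonal, Submodule.mem_orthogonal']
    intro v hv
    rw [hJ]
    refine hl v (ContinuousLinearMap.ext fun w => ?_)
    rw [hB, ← hJ]
    exact (S.mem_orthogonal v).1 hv _ ((hS _).2 ⟨w, rfl⟩)

theorem finrank_ker_eq_finrank_quotient_range (hB : ∀ v w, B v w = B w v)
    (hclosed : IsClosed (B.range : Set (H →L[ℝ] ℝ))) [FiniteDimensional ℝ B.ker] :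
    Module.finrank ℝ B.ker = Module.finrank ℝ ((H →L[ℝ] ℝ) ⧸ B.range) := by
  let r : (H →L[ℝ] ℝ) →ₗ[ℝ] B.ker →L[ℝ] ℝ := (B.ker.subtypeL.precomp ℝ).toLinearMap
  have hr : Function.Surjective r := fun l => by
    obtain ⟨l', hl', -⟩ := exists_extension_norm_eq B.ker l
    exact ⟨l', ContinuousLinearMap.ext hl'⟩
  have hker : r.ker = B.range := by
    ext l
    rw [mem_range_iff_forall_ker hB hclosed]
    simp [r, ContinuousLinearMap.ext_iff]
  rw [← hker, (r.quotKerEquivOfSurjective hr).finrank_eq,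
    ← LinearMap.toContinuousLinearMap.finrank_eq]
  exact Subspace.dual_finrank_eq.symm

theorem bijective_of_injective_of_isClosed_range (hB : ∀ v w, B v w = B w v)
    (hclosed : IsClosed (B.range : Set (H →L[ℝ] ℝ))) (hinj : Function.Injective B) :
    Function.Bijective B := by
  refine ⟨hinj, fun l => (mem_range_iff_forall_ker hB hclosed).2 fun v hv => ?_⟩
  rw [hinj (hv.trans (map_zero B).symm), map_zero]

theorem stronglyNondegenerateOn_orthogonal_ker (hB : ∀ v w, B v w = B w v)
    (hFred : B.IsFredholm) : StronglyNondegenerateOn B B.kerᗮ := by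
  have := hFred.finite_ker
  have hinj : Function.Injective (restrictForm B B.kerᗮ) := by
    refine (injective_iff_map_eq_zero _).2 fun v hv => ?_
    have hBv := apply_eq_zero_of_restrictForm_orthogonal hB le_rfl hv
    exact Subtype.ext (inner_self_eq_zero.1 (v.2 v hBv))
  exact bijective_of_injective_of_isClosed_range (B := restrictForm B B.kerᗮ) (fun v w => hB v w)
    (isFredholm_restrictForm_orthogonal hB le_rfl hFred).isClosed_range hinj

end SymmetricForm

section GenericMorse

variable {P H : Type*} [NormedAddCommGroup P] [NormedSpace ℝ P] [NormedAddCommGroup H]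
  [InnerProductSpace ℝ H] [CompleteSpace H]

theorem surjective_of_isFredholm_comp_inr {A : P × H →L[ℝ] H →L[ℝ] ℝ}
    (hsymm : ∀ v w, A (0, v) w = A (0, w) v) (hFred : (A.comp (.inr ℝ P H)).IsFredholm)
    (hT : ∀ v, A (0, v) = 0 → v ≠ 0 → ∃ p, A (p, 0) v ≠ 0) : Function.Surjective A := by
  intro l
  let B : H →L[ℝ] H →L[ℝ] ℝ := A.comp (.inr ℝ P H)
  have := hFred.finite_ker
  let a : P →ₗ[ℝ] B.ker →ₗ[ℝ] ℝ :=
    B.ker.dualRestrict ∘ₗ ContinuousLinearMap.coeLM ℝ ∘ₗ (A.comp (.inl ℝ P H)).toLinearMap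
  have ha : Function.Surjective a := by
    refine LinearMap.flip_injective_iff₂.1 ((injective_iff_map_eq_zero _).2 fun v hv => ?_)
    by_contra hv0
    obtain ⟨p, hp⟩ := hT v v.2 fun h => hv0 (Subtype.ext h)
    exact hp (DFunLike.congr_fun hv p)
  obtain ⟨p, hp⟩ := ha (l.toLinearMap ∘ₗ B.ker.subtype)
  have hl : l - A (p, 0) ∈ B.range :=
    (mem_range_iff_forall_ker hsymm hFred.isClosed_range).2 fun v hv =>
      sub_eq_zero.2 (DFunLike.congr_fun hp ⟨v, hv⟩).symm
  obtain ⟨w, hw⟩ := hl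
  have hw' : A (0, w) = l - A (p, 0) := hw
  exact ⟨(p, w), by rw [← Prod.fst_add_snd (p, w), map_add, hw', add_sub_cancel]⟩

theorem hasNowhereDenseProjAt_degenerateCriticalPoints [CompleteSpace P] {F : P × H → ℝ} {q : P × H}
    (hF : ContDiffAt ℝ 2 F q) (hcrit : fderivRight F q = 0)
    (hFred : (fderivRight (fderivRight F) q).IsFredholm)
    (hT : ∀ v, fderivRight (fderivRight F) q v = 0 → v ≠ 0 →
      ∃ p, fderiv ℝ (fderivRight F) q (p, 0) v ≠ 0) :
    HasNowhereDenseProjAt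
      {q | fderivRight F q = 0 ∧ ¬ Function.Injective (fderivRight (fderivRight F) q)} q := by
  have hΦ : ContDiffAt ℝ 1 (fderivRight F) q := contDiffAt_fderivRight (n := 1) hF
  have hΦd := hΦ.differentiableAt one_ne_zero
  have hsymm : ∀ v w, fderivRight (fderivRight F) q v w = fderivRight (fderivRight F) q w v :=
    (hF.comp q.2 (contDiff_prodMk_right q.1).contDiffAt).isSymmSndFDerivAt (by simp)
  refine hasNowhereDenseProjAt_degenerateZeros hΦ hcrit
    (surjective_of_isFredholm_comp_inr ?_ (by rwa [← fderivRight_eq hΦd]) ?_) hFred ?_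
  · simpa only [fderiv_apply_zero_left hΦd] using hsymm
  · simpa only [fderiv_apply_zero_left hΦd] using hT
  · have := hFred.finite_ker
    exact finrank_ker_eq_finrank_quotient_range hsymm hFred.isClosed_range

end GenericMorse

section SecondDerivative

variable {E E' E'' V : Type*} [NormedAddCommGroup E] [NormedSpace ℝ E]
  [NormedAddCommGroup E'] [NormedSpace ℝ E'] [NormedAddCommGroup E''] [NormedSpace ℝ E'']
  [NormedAddCommGroup V] [NormedSpace ℝ V]

theorem hasFDerivAt_clm_comp_of_eq_zero {A : E → E' →L[ℝ] V} {B : E → E'' →L[ℝ] E'} {q : E}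
    {A' : E →L[ℝ] E' →L[ℝ] V} (hA : HasFDerivAt A A' q) (hA0 : A q = 0) (hB : ContinuousAt B q) :
    HasFDerivAt (fun u => (A u).comp (B u))
      (((ContinuousLinearMap.compL ℝ E'' E' V).flip (B q)).comp A') q := by
  have hconst : HasFDerivAt (fun u => (A u).comp (B q))
      (((ContinuousLinearMap.compL ℝ E'' E' V).flip (B q)).comp A') q :=
    ((ContinuousLinearMap.compL ℝ E'' E' V).flip (B q)).hasFDerivAt.comp q hA
  have hAO : A =O[𝓝 q] fun u => u - q := by simpa [hA0] using hA.isBigO_sub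
  have hBo : (fun u => B u - B q) =o[𝓝 q] fun _ => (1 : ℝ) := by
    rw [Asymptotics.isLittleO_one_iff]
    simpa using hB.sub_const (B q)
  have hrest : HasFDerivAt (fun u => (A u).comp (B u - B q)) (0 : E →L[ℝ] E'' →L[ℝ] V) q := by
    have hprod : (fun u => (A u).comp (B u - B q)) =O[𝓝 q] fun u => ‖A u‖ * ‖B u - B q‖ :=
      .of_bound 1 (.of_forall fun u => by simpa using (A u).opNorm_comp_le (B u - B q))
    have hlittle := hprod.trans_isLittleO (hAO.norm_norm.mul_isLittleO hBo.norm_left)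
    simp only [mul_one] at hlittle
    rw [hasFDerivAt_iff_isLittleO]
    simpa [hA0] using hlittle.of_norm_right
  have hadd := hconst.add hrest
  rw [add_zero] at hadd
  exact hadd.congr_of_eventuallyEq (.of_forall fun u => by simp [ContinuousLinearMap.comp_sub])

theorem fderiv_fderiv_comp_of_critical {h : E' → ℝ} {θ : E → E'} {q : E}
    (hθ : ContDiffAt ℝ 1 θ q) (hh : ContDiffAt ℝ 2 h (θ q)) (hcrit : fderiv ℝ h (θ q) = 0)
    (v w : E) :
    fderiv ℝ (fderiv ℝ fun u => h (θ u)) q v w =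
      fderiv ℝ (fderiv ℝ h) (θ q) (fderiv ℝ θ q v) (fderiv ℝ θ q w) := by
  have hchain : fderiv ℝ (fun u => h (θ u)) =ᶠ[𝓝 q]
      fun u => (fderiv ℝ h (θ u)).comp (fderiv ℝ θ u) := by
    filter_upwards [hθ.continuousAt.eventually (hh.eventually (by simp)),
      hθ.eventually (by simp)] with u hu hu'
    exact fderiv_comp u (hu.differentiableAt (by simp)) (hu'.differentiableAt (by simp))
  have hd : DifferentiableAt ℝ (fderiv ℝ h) (θ q) :=
    (hh.fderiv_right (m := 1) (by norm_num)).differentiableAt (by simp)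
  have hA : HasFDerivAt (fun u => fderiv ℝ h (θ u))
      ((fderiv ℝ (fderiv ℝ h) (θ q)).comp (fderiv ℝ θ q)) q :=
    hd.hasFDerivAt.comp q (hθ.differentiableAt (by simp)).hasFDerivAt
  rw [hchain.fderiv_eq,
    (hasFDerivAt_clm_comp_of_eq_zero hA hcrit (hθ.continuousAt_fderiv (by simp))).fderiv]
  rfl

end SecondDerivative

section CriticalPoint

variable {E : Type*} [NormedAddCommGroup E] [NormedSpace ℝ E]
  {Y : Type*} [TopologicalSpace Y] [ChartedSpace E Y] {φ : Y → ℝ}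

theorem differential_eq_fderiv {y : Y} (hφ : MDifferentiableAt 𝓘(ℝ, E) 𝓘(ℝ, ℝ) φ y) :
    differential φ y = fderiv ℝ (fun u : E => φ ((chartAt E y).symm u)) (chartAt E y y) := by
  have h : HasFDerivWithinAt (writtenInExtChartAt 𝓘(ℝ, E) 𝓘(ℝ, ℝ) y φ)
    (differential φ y : E →L[ℝ] ℝ) (range 𝓘(ℝ, E)) (extChartAt 𝓘(ℝ, E) y y) := hφ.hasMFDerivAt.2
  simp only [mfld_simps, hasFDerivWithinAt_univ] at h
  exact h.fderiv.symm

theorem IsCritical.diffeomorph {s : Y ≃ₘ^1⟮𝓘(ℝ, E), 𝓘(ℝ, E)⟯ Y} {y : Y}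
    (hs : (fun z => φ (s z)) =ᶠ[𝓝 y] φ) (hφ : MDifferentiableAt 𝓘(ℝ, E) 𝓘(ℝ, ℝ) φ (s y))
    (hc : IsCritical E φ y) : IsCritical E φ (s y) := by
  have hcomp := mfderiv_comp y hφ (s.contMDiff.mdifferentiableAt (by simp))
  ext v
  obtain ⟨v, rfl⟩ := (s.mfderivToContinuousLinearEquiv (by simp) y).surjective v
  exact (congrArg (fun l => l v) (hcomp.symm.trans (hs.mfderiv_eq.trans hc)) :)

theorem fderiv_comp_chart_symm_eq_zero [IsManifold 𝓘(ℝ, E) 1 Y] {y₀ y : Y}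
    (hy : y ∈ (chartAt E y₀).source) (hφ : MDifferentiableAt 𝓘(ℝ, E) 𝓘(ℝ, ℝ) φ y)
    (hc : IsCritical E φ y) :
    fderiv ℝ (fun u : E => φ ((chartAt E y₀).symm u)) (chartAt E y₀ y) = 0 := by
  have hu := (chartAt E y₀).map_source hy
  rw [← (chartAt E y₀).left_inv hy] at hφ hc
  rw [← mfderiv_eq_fderiv]
  refine (mfderiv_comp _ hφ (mdifferentiableAt_atlas_symm (chart_mem_atlas E y₀) hu)).trans ?_
  exact (congrArg (fun l : E →L[ℝ] ℝ => l.comp _) hc).trans (ContinuousLinearMap.zero_comp _)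

theorem contDiffAt_diffeomorph_inCharts [IsManifold 𝓘(ℝ, E) 1 Y]
    {s : Y ≃ₘ^1⟮𝓘(ℝ, E), 𝓘(ℝ, E)⟯ Y} {y y₀ : Y} (hy : s y ∈ (chartAt E y₀).source) :
    ContDiffAt ℝ 1 (fun u => chartAt E y₀ (s ((chartAt E y).symm u))) (chartAt E y y) := by
  rw [← (chartAt E y).left_inv (mem_chart_source E y)] at hy
  have hchart : ContMDiffAt 𝓘(ℝ, E) 𝓘(ℝ, E) 1 (chartAt E y₀)
      (s ((chartAt E y).symm (chartAt E y y))) :=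
    contMDiffOn_chart.contMDiffAt ((chartAt E y₀).open_source.mem_nhds hy)
  have hsymm : ContMDiffAt 𝓘(ℝ, E) 𝓘(ℝ, E) 1 (chartAt E y).symm (chartAt E y y) :=
    contMDiffOn_chart_symm.contMDiffAt ((chartAt E y).open_target.mem_nhds (mem_chart_target E y))
  exact contMDiffAt_iff_contDiffAt.1 (hchart.comp (chartAt E y y)
    (s.contMDiff.contMDiffAt.comp (chartAt E y y) hsymm))

variable [IsManifold 𝓘(ℝ, E) 2 Y]

theorem contDiffAt_comp_chart_symm {y₀ : Y} {u : E} (hu : u ∈ (chartAt E y₀).target)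
    (hφ : ContMDiffAt 𝓘(ℝ, E) 𝓘(ℝ, ℝ) 2 φ ((chartAt E y₀).symm u)) :
    ContDiffAt ℝ 2 (fun u : E => φ ((chartAt E y₀).symm u)) u := by
  rw [← contMDiffAt_iff_contDiffAt]
  exact hφ.comp u (contMDiffOn_chart_symm.contMDiffAt ((chartAt E y₀).open_target.mem_nhds hu))

theorem contDiffAt_comp_chart_symm_self {y : Y} (hφ : ContMDiffAt 𝓘(ℝ, E) 𝓘(ℝ, ℝ) 2 φ y) :
    ContDiffAt ℝ 2 (fun u : E => φ ((chartAt E y).symm u)) (chartAt E y y) :=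
  contDiffAt_comp_chart_symm (mem_chart_target E y)
    (((chartAt E y).left_inv (mem_chart_source E y)).symm ▸ hφ)

theorem hessian_symm {y : Y} (hφ : ContMDiffAt 𝓘(ℝ, E) 𝓘(ℝ, ℝ) 2 φ y) (v w : E) :
    hessian φ y v w = hessian φ y w v :=
  (contDiffAt_comp_chart_symm_self hφ).isSymmSndFDerivAt (by simp) v w

theorem exists_hessian_eq_fderiv_fderiv_diffeomorph {s : Y ≃ₘ^1⟮𝓘(ℝ, E), 𝓘(ℝ, E)⟯ Y} {y y₀ : Y}
    (hs : (fun z => φ (s z)) =ᶠ[𝓝 y] φ) (hφ : ContMDiffAt 𝓘(ℝ, E) 𝓘(ℝ, ℝ) 2 φ (s y))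
    (hc : IsCritical E φ y) (hy : s y ∈ (chartAt E y₀).source) :
    ∃ T : E ≃L[ℝ] E, ∀ v w, hessian φ y v w =
      fderiv ℝ (fderiv ℝ fun u => φ ((chartAt E y₀).symm u)) (chartAt E y₀ (s y)) (T v) (T w) := by
  have : IsManifold 𝓘(ℝ, E) 1 Y := .of_le one_le_two
  set c := chartAt E y
  set e := chartAt E y₀
  let θ := c.symm ≫ₕ s.toHomeomorph.toOpenPartialHomeomorph ≫ₕ e
  have hcy : c.symm (c y) = y := c.left_inv (mem_chart_source E y)
  have hθy : θ (c y) = e (s y) := by simp [θ, hcy]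
  have hmem : c y ∈ θ.source := by simpa [θ, hcy, c] using hy
  have hθ : θ.MDifferentiable 𝓘(ℝ, E) 𝓘(ℝ, E) :=
    (mdifferentiable_chart y).symm.trans
      (.trans ⟨(s.contMDiff.mdifferentiable (by simp)).mdifferentiableOn,
        (s.symm.contMDiff.mdifferentiable (by simp)).mdifferentiableOn⟩ (mdifferentiable_chart y₀))
  have hφθ : (fun u => φ (c.symm u)) =ᶠ[𝓝 (c y)] fun u => φ (e.symm (θ u)) := by
    have hlim := c.continuousAt_symm (mem_chart_target E y)
    rw [ContinuousAt, hcy] at hlim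
    filter_upwards [hlim.eventually hs, θ.open_source.mem_nhds hmem] with u hu hu'
    rw [← hu]
    exact congrArg φ (e.left_inv hu'.2.2).symm
  refine ⟨hθ.mfderiv hmem, fun v w => ?_⟩
  have hsec := fderiv_fderiv_comp_of_critical (h := fun u => φ (e.symm u)) (θ := θ)
    (contDiffAt_diffeomorph_inCharts hy)
      (hθy ▸ contDiffAt_comp_chart_symm (e.map_source hy)
      ((e.left_inv hy).symm ▸ hφ)) (hθy ▸ fderiv_comp_chart_symm_eq_zero hy
        (hφ.mdifferentiableAt (by simp)) (hc.diffeomorph hs (hφ.mdifferentiableAt (by simp)))) v w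
  rw [hθy, ← hφθ.fderiv.fderiv_eq, ← mfderiv_eq_fderiv (f := θ)] at hsec
  exact hsec

end CriticalPoint

section OrbitsInCharts

variable {E EG G Y : Type*} [NormedAddCommGroup EG] [NormedAddCommGroup E] [TopologicalSpace G]
  [ChartedSpace EG G] [Group G] [TopologicalSpace Y] [ChartedSpace E Y] [MulAction G Y]

variable (E EG G) in
/-- The action of `G` on `Y`, read in the preferred charts at `1` and `y₀`. -/
def chartAction (y₀ : Y) (q : EG × E) : E :=
  chartAt E y₀ ((chartAt EG (1 : G)).symm q.1 • (chartAt E y₀).symm q.2)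

theorem chartAction_one (y₀ : Y) {u : E} (hu : u ∈ (chartAt E y₀).target) :
    chartAction E EG G y₀ (chartAt EG (1 : G) 1, u) = u := by
  simp [chartAction, hu]

theorem tendsto_chart_symm_smul_chart_symm [ContinuousSMul G Y] (y : Y) :
    Tendsto (fun q : EG × E => (chartAt EG (1 : G)).symm q.1 • (chartAt E y).symm q.2)
      (𝓝 (chartAt EG (1 : G) 1, chartAt E y y)) (𝓝 y) := by
  have h := (((chartAt EG (1 : G)).continuousAt_symm (mem_chart_target EG 1)).tendsto.comp
    continuousAt_fst.tendsto).smul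
      (((chartAt E y).continuousAt_symm (mem_chart_target E y)).tendsto.comp
        (continuousAt_snd (p := (chartAt EG (1 : G) 1, chartAt E y y))).tendsto)
  simpa using h

variable (EG G) in
theorem tendsto_chart_symm_smul [ContinuousSMul G Y] (y : Y) :
    Tendsto (fun t => (chartAt EG (1 : G)).symm t • y) (𝓝 (chartAt EG (1 : G) 1)) (𝓝 y) := by
  have h := ((chartAt EG (1 : G)).continuousAt_symm (mem_chart_target EG 1)).smul
    (continuousAt_const (y := y))
  simpa [ContinuousAt, Pi.smul_def'] using h

variable [NormedSpace ℝ EG] [NormedSpace ℝ E]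

variable [ContMDiffSMul 𝓘(ℝ, EG) 𝓘(ℝ, E) 1 G Y]

variable (EG G) in
theorem contDiffAt_chartAction (y₀ : Y) :
    ContDiffAt ℝ 1 (chartAction E EG G y₀) (chartAt EG (1 : G) 1, chartAt E y₀ y₀) := by
  have h := ContMDiffSMul.contMDiff_smul (I := 𝓘(ℝ, EG)) (I' := 𝓘(ℝ, E)) (n := 1) ((1 : G), y₀)
  rw [contMDiffAt_iff] at h
  have h2 := h.2
  simp only [mfld_simps, one_smul, Prod.map_id, range_id, contDiffWithinAt_univ] at h2
  exact h2

variable (EG G) in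
theorem hasFDerivAt_chartAction_self (y₀ : Y) :
    HasFDerivAt (fun t => chartAction E EG G y₀ (t, chartAt E y₀ y₀))
      (orbitDifferential (EG := EG) (E := E) G y₀) (chartAt EG (1 : G) 1) := by
  have hsmul : ContMDiff 𝓘(ℝ, EG) 𝓘(ℝ, E) 1 (fun g : G => g • y₀) :=
    contMDiff_id.smul contMDiff_const
  have h : HasFDerivWithinAt (writtenInExtChartAt 𝓘(ℝ, EG) 𝓘(ℝ, E) 1 (fun g : G => g • y₀))
    (orbitDifferential (EG := EG) (E := E) G y₀) (range 𝓘(ℝ, EG))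
    (extChartAt 𝓘(ℝ, EG) (1 : G) 1) := (hsmul.mdifferentiableAt (by simp)).hasMFDerivAt.2
  simp only [mfld_simps, one_smul, hasFDerivWithinAt_univ] at h
  exact h.congr_of_eventuallyEq (.of_forall fun t => by simp [chartAction])

theorem hasFDerivAt_chartAction [IsManifold 𝓘(ℝ, E) 1 Y] {y₀ y : Y}
    (hy : y ∈ (chartAt E y₀).source) :
    HasFDerivAt (fun t => chartAction E EG G y₀ (t, chartAt E y₀ y))
      ((fderiv ℝ (fun u => chartAt E y₀ ((chartAt E y).symm u)) (chartAt E y y)).comp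
        (orbitDifferential (EG := EG) (E := E) G y)) (chartAt EG (1 : G) 1) := by
  have : ContinuousSMul G Y := ContMDiffSMul.continuousSMul (I := 𝓘(ℝ, EG)) (I' := 𝓘(ℝ, E)) 1
  have htrans : DifferentiableAt ℝ (fun u => chartAt E y₀ ((chartAt E y).symm u))
      (chartAt E y y) :=
    (contDiffAt_diffeomorph_inCharts (s := .refl _ Y 1) hy).differentiableAt (by simp)
  have hself := chartAction_one (EG := EG) (G := G) y (mem_chart_target E y)
  have hcomp := HasFDerivAt.comp (chartAt EG (1 : G) 1) (hself.symm ▸ htrans.hasFDerivAt)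
    (hasFDerivAt_chartAction_self EG G y)
  rw [hself] at hcomp
  refine hcomp.congr_of_eventuallyEq ?_
  filter_upwards [(tendsto_chart_symm_smul EG G y).eventually (chart_source_mem_nhds E y)]
    with t ht
  simp [chartAction, (chartAt E y₀).left_inv hy, (chartAt E y).left_inv ht]

theorem eventually_finrank_orbitTangent_le_rank [IsManifold 𝓘(ℝ, E) 1 Y] (y₀ : Y) :
    ∀ᶠ y in 𝓝 y₀, (Module.finrank ℝ (orbitTangent (E := E) G EG y₀) : Cardinal) ≤
      Module.rank ℝ (orbitTangent (E := E) G EG y) := by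
  set t₀ := chartAt EG (1 : G) 1
  let L : E → EG →L[ℝ] E :=
    fun u => (fderiv ℝ (chartAction E EG G y₀) (t₀, u)).comp (.inl ℝ EG E)
  have hC1 := contDiffAt_chartAction (E := E) EG G y₀
  have hL : ContinuousAt L (chartAt E y₀ y₀) :=
    ((hC1.continuousAt_fderiv (by simp)).comp
      (Continuous.prodMk_right t₀).continuousAt).clm_comp continuousAt_const
  have hLd : ∀ᶠ u in 𝓝 (chartAt E y₀ y₀),
      HasFDerivAt (fun t => chartAction E EG G y₀ (t, u)) (L u) t₀ := by
    filter_upwards [(Continuous.prodMk_right t₀).continuousAt.eventually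
      (hC1.eventually (by simp))] with u hu
    exact HasFDerivAt.comp (f := fun t => (t, u)) t₀
      (hu.differentiableAt (by simp)).hasFDerivAt (hasFDerivAt_prodMk_left t₀ u)
  have hL₀ : L (chartAt E y₀ y₀) = orbitDifferential G y₀ :=
    hLd.self_of_nhds.unique (hasFDerivAt_chartAction_self EG G y₀)
  have hrank : ∀ᶠ u in 𝓝 (chartAt E y₀ y₀),
      (Module.finrank ℝ (orbitTangent (E := E) G EG y₀) : Cardinal) ≤
        (L u : EG →ₗ[ℝ] E).rank := by
    refine hL.eventually ((isOpen_setOfPred_nat_le_rank _).mem_nhds ?_)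
    rw [hL₀]
    exact Cardinal.natCast_toNat_le _
  have hchart := (chartAt E y₀).continuousAt (mem_chart_source E y₀)
  filter_upwards [hchart.eventually hLd, hchart.eventually hrank, chart_source_mem_nhds E y₀]
    with y hd hr hy
  rw [hd.unique (hasFDerivAt_chartAction hy)] at hr
  exact hr.trans (LinearMap.rank_comp_le_right _ _)

end OrbitsInCharts

section InvariantFunction

variable {E EG G Y : Type*} [NormedAddCommGroup EG] [NormedSpace ℝ EG] [NormedAddCommGroup E]
  [NormedSpace ℝ E] [TopologicalSpace G] [ChartedSpace EG G] [Group G] [TopologicalSpace Y]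
  [ChartedSpace E Y] [MulAction G Y] [ContMDiffSMul 𝓘(ℝ, EG) 𝓘(ℝ, E) 1 G Y]
  [IsManifold 𝓘(ℝ, E) 2 Y] {φ : Y → ℝ} {y : Y}

variable (EG) in
theorem orbitTangent_le_ker_hessian (hφG : ∀ g : G, (fun z => φ (g • z)) =ᶠ[𝓝 y] φ)
    (hφ : ContMDiffAt 𝓘(ℝ, E) 𝓘(ℝ, ℝ) 2 φ y) (hc : IsCritical E φ y) :
    orbitTangent (E := E) G EG y ≤ (hessian φ y).ker := by
  have : IsManifold 𝓘(ℝ, E) 1 Y := .of_le one_le_two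
  have : ContinuousSMul G Y := ContMDiffSMul.continuousSMul (I := 𝓘(ℝ, EG)) (I' := 𝓘(ℝ, E)) 1
  have hself := chartAction_one (EG := EG) (G := G) y (mem_chart_target E y)
  have hcrit : (fun t => fderiv ℝ (fun u => φ ((chartAt E y).symm u))
      (chartAction E EG G y (t, chartAt E y y))) =ᶠ[𝓝 (chartAt EG (1 : G) 1)] fun _ => 0 := by
    filter_upwards [(tendsto_chart_symm_smul EG G y).eventually
      (chart_source_mem_nhds E y), (tendsto_chart_symm_smul EG G y).eventually
      ((contMDiffAt_iff_contMDiffAt_nhds (by simp)).1 hφ)] with t ht hφt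
    rw [chartAction, (chartAt E y).left_inv (mem_chart_source E y)]
    have hd := hφt.mdifferentiableAt (by simp)
    exact fderiv_comp_chart_symm_eq_zero ht hd
      (hc.diffeomorph (s := .smul 𝓘(ℝ, EG) 𝓘(ℝ, E) 1 _) (hφG _) hd)
  have hd : DifferentiableAt ℝ (fderiv ℝ fun u => φ ((chartAt E y).symm u)) (chartAt E y y) :=
    ((contDiffAt_comp_chart_symm_self hφ).fderiv_right (m := 1) (by norm_num)).differentiableAt
      (by simp)
  have hcomp := HasFDerivAt.comp (chartAt EG (1 : G) 1) (hself.symm ▸ hd.hasFDerivAt)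
    (hasFDerivAt_chartAction_self EG G y)
  rw [hself] at hcomp
  rintro _ ⟨ξ, rfl⟩
  exact DFunLike.congr_fun (hcomp.unique ((hasFDerivAt_const 0 _).congr_of_eventuallyEq hcrit)) ξ

end InvariantFunction

section Slice

variable {E EG G Y : Type*} [NormedAddCommGroup EG] [NormedSpace ℝ EG] [NormedAddCommGroup E]
  [NormedSpace ℝ E] [TopologicalSpace G] [ChartedSpace EG G] [Group G] [TopologicalSpace Y]
  [ChartedSpace E Y] [MulAction G Y] [ContMDiffSMul 𝓘(ℝ, EG) 𝓘(ℝ, E) 1 G Y]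

variable (EG G) in
theorem hasStrictFDerivAt_chartAction (y₀ : Y) :
    HasStrictFDerivAt (chartAction E EG G y₀)
      ((orbitDifferential (EG := EG) G y₀).coprod (.id ℝ E))
      (chartAt EG (1 : G) 1, chartAt E y₀ y₀) := by
  have hstrict := (contDiffAt_chartAction EG G (E := E) y₀).hasStrictFDerivAt (by simp)
  refine hstrict.congr_fderiv (ContinuousLinearMap.prod_ext ?_ ?_)
  · rw [ContinuousLinearMap.coprod_comp_inl]
    exact (HasFDerivAt.comp (f := fun t => (t, chartAt E y₀ y₀)) _ hstrict.hasFDerivAt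
      (hasFDerivAt_prodMk_left _ _)).unique (hasFDerivAt_chartAction_self EG G y₀)
  · rw [ContinuousLinearMap.coprod_comp_inr]
    refine (HasFDerivAt.comp (f := fun u => (chartAt EG (1 : G) 1, u)) _ hstrict.hasFDerivAt
      (hasFDerivAt_prodMk_right _ _)).unique ((hasFDerivAt_id _).congr_of_eventuallyEq ?_)
    filter_upwards [(chartAt E y₀).open_target.mem_nhds (mem_chart_target E y₀)] with u hu
    exact chartAction_one y₀ hu

variable (EG G) in
theorem eventually_exists_smul_eq_chart_symm_add [CompleteSpace EG] [CompleteSpace E] {y₀ : Y}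
    {W : Submodule ℝ E} [CompleteSpace W] (hW : orbitTangent G EG y₀ ⊔ W = ⊤) {V : Set W}
    (hV : V ∈ 𝓝 0) :
    ∀ᶠ y in 𝓝 y₀, ∃ g : G, ∃ w ∈ V,
      g • y = (chartAt E y₀).symm (chartAt E y₀ y₀ + w) := by
  have : ContinuousSMul G Y := ContMDiffSMul.continuousSMul (I := 𝓘(ℝ, EG)) (I' := 𝓘(ℝ, E)) 1
  set e := chartAt E y₀
  set t₀ := chartAt EG (1 : G) 1
  let γ : EG × W → EG × E := fun q => (q.1, e y₀ + q.2)
  have hγ₀ : γ (t₀, 0) = (t₀, e y₀) := by simp [γ]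
  have hγ : HasStrictFDerivAt γ (.prodMap (.id ℝ EG) W.subtypeL) (t₀, 0) :=
    hasStrictFDerivAt_fst.prodMk ((W.subtypeL.hasStrictFDerivAt.comp _
      hasStrictFDerivAt_snd).const_add (e y₀))
  have hstrict := HasStrictFDerivAt.comp (t₀, (0 : W))
    (hγ₀.symm ▸ hasStrictFDerivAt_chartAction (E := E) EG G y₀) hγ
  have hsource : ∀ᶠ q in 𝓝 (t₀, (0 : W)),
      q.2 ∈ V ∧ (chartAt EG (1 : G)).symm q.1 • e.symm (e y₀ + q.2) ∈ e.source := by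
    have hlim := (tendsto_chart_symm_smul_chart_symm (E := E) (EG := EG) (G := G) y₀).comp
      (hγ₀ ▸ hγ.continuousAt.tendsto)
    exact (continuousAt_snd.tendsto.eventually_mem hV).and
      (hlim.eventually_mem (chart_source_mem_nhds E y₀))
  have hsurj : ((orbitDifferential (EG := EG) G y₀).coprod (.id ℝ E) ∘SL
      .prodMap (.id ℝ EG) W.subtypeL).range = ⊤ := by
    have hcoprod : (orbitDifferential (EG := EG) G y₀).coprod (.id ℝ E) ∘SL
        .prodMap (.id ℝ EG) W.subtypeL = (orbitDifferential G y₀).coprod W.subtypeL := by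
      ext <;> simp
    rw [hcoprod, ContinuousLinearMap.range_coprod]
    simpa [orbitTangent] using hW
  have himage := image_mem_map (m := fun q => chartAction E EG G y₀ (γ q)) hsource
  rw [hstrict.map_nhds_eq_of_surj hsurj, hγ₀, chartAction_one y₀ (mem_chart_target E y₀)] at himage
  filter_upwards [(e.continuousAt (mem_chart_source E y₀)).eventually himage,
    chart_source_mem_nhds E y₀] with y hq hy
  obtain ⟨⟨t, w⟩, ⟨hw, htw⟩, hy'⟩ := hq
  exact ⟨((chartAt EG (1 : G)).symm t)⁻¹, w, hw, inv_smul_eq_iff.2 (e.injOn htw hy hy').symm⟩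

end Slice

section InvariantFunctionHilbert

variable {E EG G Y : Type*} [NormedAddCommGroup EG] [NormedSpace ℝ EG] [NormedAddCommGroup E]
  [InnerProductSpace ℝ E] [CompleteSpace E] [TopologicalSpace G] [ChartedSpace EG G] [Group G]
  [TopologicalSpace Y] [ChartedSpace E Y] [MulAction G Y] [IsManifold 𝓘(ℝ, E) 2 Y]
  [ContMDiffSMul 𝓘(ℝ, EG) 𝓘(ℝ, E) 1 G Y] {φ : Y → ℝ} {y : Y}

variable (EG) in
theorem isGNondegenerateAt_of_finrank_ker_le_rank (hφG : ∀ g : G, (fun z => φ (g • z)) =ᶠ[𝓝 y] φ)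
    (hφ : ContMDiffAt 𝓘(ℝ, E) 𝓘(ℝ, ℝ) 2 φ y) (hc : IsCritical E φ y)
    (hFred : (hessian (E := E) φ y).IsFredholm)
    (hrank : (Module.finrank ℝ (hessian (E := E) φ y).ker : Cardinal) ≤
      Module.rank ℝ (orbitTangent (E := E) G EG y)) : IsGNondegenerateAt G EG E φ y := by
  have := hFred.finite_ker
  have hle := orbitTangent_le_ker_hessian EG hφG hφ hc
  have := Submodule.finiteDimensional_of_le hle
  have heq : orbitTangent (E := E) G EG y = (hessian (E := E) φ y).ker :=
    Submodule.eq_of_le_of_finrank_le hle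
      (by rwa [← Module.finrank_eq_rank, Nat.cast_le] at hrank)
  refine ⟨(hessian (E := E) φ y).kerᗮ, Submodule.isClosed_orthogonal _, ?_,
    stronglyNondegenerateOn_orthogonal_ker (hessian_symm hφ) hFred⟩
  rw [heq]
  exact Submodule.isCompl_orthogonal _

end InvariantFunctionHilbert

section SliceFamily

variable {EX : Type*} [NormedAddCommGroup EX] {X : Type*} [TopologicalSpace X] [ChartedSpace EX X]
  {EY : Type*} [NormedAddCommGroup EY] [NormedSpace ℝ EY]
  {Y : Type*} [TopologicalSpace Y] [ChartedSpace EY Y] {f : X × Y → ℝ} {x₀ : X} {y₀ : Y}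
  {W : Submodule ℝ EY}

/-- The function `f` on `X × Y`, read in the preferred charts at `x₀` and `y₀` and restricted in
the second variable to the affine slice through `y₀` with direction `W`. -/
def sliceFamily (f : X × Y → ℝ) (x₀ : X) (y₀ : Y) (W : Submodule ℝ EY) (q : EX × W) : ℝ :=
  f ((chartAt EX x₀).symm q.1, (chartAt EY y₀).symm (chartAt EY y₀ y₀ + q.2))

theorem sliceFamily_chart {x : X} (hx : x ∈ (chartAt EX x₀).source) (w : W) :
    sliceFamily f x₀ y₀ W (chartAt EX x₀ x, w) =
      f (x, (chartAt EY y₀).symm (chartAt EY y₀ y₀ + w)) := by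
  rw [sliceFamily, (chartAt EX x₀).left_inv hx]

theorem hasFDerivAt_const_add_subtype (u : EY) (w : W) :
    HasFDerivAt (fun w : W => u + (w : EY)) W.subtypeL w :=
  W.subtypeL.hasFDerivAt.const_add u

theorem fderivRight_sliceFamily {x : X} {w : W} (hx : x ∈ (chartAt EX x₀).source)
    (hd : DifferentiableAt ℝ (fun u => f (x, (chartAt EY y₀).symm u)) (chartAt EY y₀ y₀ + w)) :
    fderivRight (sliceFamily f x₀ y₀ W) (chartAt EX x₀ x, w) =
      (fderiv ℝ (fun u => f (x, (chartAt EY y₀).symm u)) (chartAt EY y₀ y₀ + w)).comp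
        W.subtypeL := by
  simp only [fderivRight, sliceFamily_chart hx]
  exact (hd.hasFDerivAt.comp w (hasFDerivAt_const_add_subtype _ w)).fderiv

theorem fderivRight_sliceFamily_eq_zero [IsManifold 𝓘(ℝ, EY) 2 Y] {x : X} {w : W}
    (hx : x ∈ (chartAt EX x₀).source) (hw : chartAt EY y₀ y₀ + w ∈ (chartAt EY y₀).target)
    (hf : ContMDiffAt 𝓘(ℝ, EY) 𝓘(ℝ, ℝ) 2 (fun y => f (x, y))
      ((chartAt EY y₀).symm (chartAt EY y₀ y₀ + w)))
    (hc : IsCritical EY (fun y => f (x, y)) ((chartAt EY y₀).symm (chartAt EY y₀ y₀ + w))) :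
    fderivRight (sliceFamily f x₀ y₀ W) (chartAt EX x₀ x, w) = 0 := by
  have : IsManifold 𝓘(ℝ, EY) 1 Y := .of_le one_le_two
  have hzero := fderiv_comp_chart_symm_eq_zero ((chartAt EY y₀).map_target hw)
    (hf.mdifferentiableAt (by simp)) hc
  rw [(chartAt EY y₀).right_inv hw] at hzero
  rw [fderivRight_sliceFamily hx ((contDiffAt_comp_chart_symm hw hf).differentiableAt (by simp)),
    hzero, ContinuousLinearMap.zero_comp]

theorem fderivRight_fderivRight_sliceFamily [IsManifold 𝓘(ℝ, EY) 2 Y] {x : X} {w : W}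
    (hx : x ∈ (chartAt EX x₀).source) (hw : chartAt EY y₀ y₀ + w ∈ (chartAt EY y₀).target)
    (hf : ContMDiffAt 𝓘(ℝ, EY) 𝓘(ℝ, ℝ) 2 (fun y => f (x, y))
      ((chartAt EY y₀).symm (chartAt EY y₀ y₀ + w)))
    (hc : IsCritical EY (fun y => f (x, y)) ((chartAt EY y₀).symm (chartAt EY y₀ y₀ + w))) :
    fderivRight (fderivRight (sliceFamily f x₀ y₀ W)) (chartAt EX x₀ x, w) =
      restrictForm (fderiv ℝ (fderiv ℝ fun u => f (x, (chartAt EY y₀).symm u))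
        (chartAt EY y₀ y₀ + w)) W := by
  have : IsManifold 𝓘(ℝ, EY) 1 Y := .of_le one_le_two
  have hzero := fderiv_comp_chart_symm_eq_zero ((chartAt EY y₀).map_target hw)
    (hf.mdifferentiableAt (by simp)) hc
  rw [(chartAt EY y₀).right_inv hw] at hzero
  have hθ : ContDiff ℝ 1 fun w : W => chartAt EY y₀ y₀ + (w : EY) :=
    contDiff_const.add W.subtypeL.contDiff
  ext v v'
  unfold fderivRight
  simp only [sliceFamily_chart hx]
  rw [fderiv_fderiv_comp_of_critical (h := fun u => f (x, (chartAt EY y₀).symm u))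
    hθ.contDiffAt (contDiffAt_comp_chart_symm hw hf) hzero,
    (hasFDerivAt_const_add_subtype _ w).fderiv]
  rfl

theorem fderivRight_fderivRight_sliceFamily_self [IsManifold 𝓘(ℝ, EY) 2 Y]
    (hf : ContMDiffAt 𝓘(ℝ, EY) 𝓘(ℝ, ℝ) 2 (fun y => f (x₀, y)) y₀)
    (hc : IsCritical EY (fun y => f (x₀, y)) y₀) :
    fderivRight (fderivRight (sliceFamily f x₀ y₀ W)) (chartAt EX x₀ x₀, 0) =
      restrictForm (hessian (fun y => f (x₀, y)) y₀) W := by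
  rw [fderivRight_fderivRight_sliceFamily (mem_chart_source EX x₀)] <;> simp [hessian, hf, hc]

variable [NormedSpace ℝ EX]

theorem contMDiffAt_curry_right {x : X} {y : Y}
    (hf : ContMDiffAt (𝓘(ℝ, EX).prod 𝓘(ℝ, EY)) 𝓘(ℝ, ℝ) 2 f (x, y)) :
    ContMDiffAt 𝓘(ℝ, EY) 𝓘(ℝ, ℝ) 2 (fun y => f (x, y)) y :=
  ContMDiffAt.comp (g := f) y hf (contMDiffAt_const.prodMk contMDiffAt_id)

theorem contDiffAt_sliceFamily [IsManifold 𝓘(ℝ, EX) 2 X] [IsManifold 𝓘(ℝ, EY) 2 Y] {p : EX} {w : W}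
    (hp : p ∈ (chartAt EX x₀).target) (hw : chartAt EY y₀ y₀ + w ∈ (chartAt EY y₀).target)
    (hf : ContMDiffAt (𝓘(ℝ, EX).prod 𝓘(ℝ, EY)) 𝓘(ℝ, ℝ) 2 f
      ((chartAt EX x₀).symm p, (chartAt EY y₀).symm (chartAt EY y₀ y₀ + w))) :
    ContDiffAt ℝ 2 (sliceFamily (EX := EX) f x₀ y₀ W) (p, w) := by
  rw [← contMDiffAt_iff_contDiffAt]
  have hX : ContMDiffAt 𝓘(ℝ, EX) 𝓘(ℝ, EX) 2 (chartAt EX x₀).symm p :=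
    (contMDiffOn_chart_symm (n := 2) (x := x₀)).contMDiffAt
      ((chartAt EX x₀).open_target.mem_nhds hp)
  have hY : ContMDiffAt 𝓘(ℝ, EY) 𝓘(ℝ, EY) 2 (chartAt EY y₀).symm (chartAt EY y₀ y₀ + w) :=
    (contMDiffOn_chart_symm (n := 2) (x := y₀)).contMDiffAt
      ((chartAt EY y₀).open_target.mem_nhds hw)
  have hW : ContMDiffAt 𝓘(ℝ, EX × W) 𝓘(ℝ, EY) 2
      (fun q : EX × W => chartAt EY y₀ y₀ + (q.2 : EY)) (p, w) :=
    (contDiff_const.add (W.subtypeL.contDiff.comp contDiff_snd)).contMDiff.contMDiffAt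
  exact ContMDiffAt.comp (g := f) (p, w) hf
    ((hX.comp (p, w) contDiff_fst.contMDiff.contMDiffAt).prodMk (hY.comp (p, w) hW))

theorem differential_comp_chart [IsManifold 𝓘(ℝ, EX) 1 X] {ψ : EX → ℝ} {ψ' : EX →L[ℝ] ℝ}
    (hψ : HasFDerivAt ψ ψ' (chartAt EX x₀ x₀)) :
    differential (fun x => ψ (chartAt EX x₀ x)) x₀ = ψ' := by
  have hchart : MDifferentiableAt 𝓘(ℝ, EX) 𝓘(ℝ, EX) (chartAt EX x₀) x₀ :=
    (contMDiffOn_chart.contMDiffAt (chart_source_mem_nhds EX x₀)).mdifferentiableAt one_ne_zero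
  have hd := MDifferentiableAt.comp (g := ψ) x₀ hψ.differentiableAt.mdifferentiableAt hchart
  refine (differential_eq_fderiv hd).trans (hψ.congr_of_eventuallyEq ?_).fderiv
  filter_upwards [(chartAt EX x₀).open_target.mem_nhds (mem_chart_target EX x₀)] with p hp
  rw [Function.comp_apply, (chartAt EX x₀).right_inv hp]

theorem fderiv_fderivRight_sliceFamily_eq_mixedDerivative [IsManifold 𝓘(ℝ, EX) 2 X]
    [IsManifold 𝓘(ℝ, EY) 2 Y]
    (hf : ContMDiffAt (𝓘(ℝ, EX).prod 𝓘(ℝ, EY)) 𝓘(ℝ, ℝ) 2 f (x₀, y₀)) (p : EX) (v : W) :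
    fderiv ℝ (fderivRight (sliceFamily f x₀ y₀ W)) (chartAt EX x₀ x₀, 0) (p, 0) v =
      mixedDerivative f x₀ y₀ (v : EY) p := by
  have : IsManifold 𝓘(ℝ, EX) 1 X := .of_le one_le_two
  have hev : (fun x => differential (E := EY) (fun y => f (x, y)) y₀ (v : EY)) =ᶠ[𝓝 x₀]
      fun x => fderivRight (sliceFamily f x₀ y₀ W) (chartAt EX x₀ x, 0) v := by
    filter_upwards [(Continuous.prodMk_left y₀).continuousAt.eventually
      ((contMDiffAt_iff_contMDiffAt_nhds (by simp)).1 hf), chart_source_mem_nhds EX x₀]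
      with x hfx hx
    have hfx' := contMDiffAt_curry_right hfx
    have hd := (contDiffAt_comp_chart_symm_self hfx').differentiableAt (by simp)
    rw [differential_eq_fderiv (hfx'.mdifferentiableAt (by simp)),
      fderivRight_sliceFamily hx (by simpa using hd)]
    simp
  have hF : ContDiffAt ℝ 2 (sliceFamily f x₀ y₀ W) (chartAt EX x₀ x₀, 0) :=
    contDiffAt_sliceFamily (mem_chart_target EX x₀) (by simp) (by simpa using hf)
  have hd := (contDiffAt_fderivRight (n := 1) hF).differentiableAt one_ne_zero
  have hψ := (HasFDerivAt.comp (f := fun p => (p, (0 : W))) _ hd.hasFDerivAt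
    (hasFDerivAt_prodMk_left _ _)).clm_apply (hasFDerivAt_const v _)
  rw [mixedDerivative, differential, hev.mfderiv_eq]
  refine Eq.trans ?_ (DFunLike.congr_fun (differential_comp_chart hψ) p).symm
  simp

end SliceFamily

section GenericInvariant

theorem eventuallyEq_comp_smul {G X Y Z : Type*} [TopologicalSpace X] [TopologicalSpace Y]
    [SMul G Y] {A : Set (X × Y)} {f : X × Y → Z} (hA : IsOpen A)
    (hfG : ∀ (x : X) (y : Y) (g : G), (x, y) ∈ A → f (x, g • y) = f (x, y)) {x : X} {y : Y}
    (hxy : (x, y) ∈ A) (g : G) : (fun z => f (x, g • z)) =ᶠ[𝓝 y] fun z => f (x, z) := by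
  filter_upwards [(Continuous.prodMk_right x).continuousAt.eventually (hA.mem_nhds hxy)] with z hz
  exact hfG x z g hz

variable {EG : Type*} [NormedAddCommGroup EG] [NormedSpace ℝ EG]
  {G : Type*} [TopologicalSpace G] [ChartedSpace EG G] [Group G]
  {EY : Type*} [NormedAddCommGroup EY] [InnerProductSpace ℝ EY] [CompleteSpace EY]
  {Y : Type*} [TopologicalSpace Y] [ChartedSpace EY Y] [IsManifold 𝓘(ℝ, EY) 2 Y]
  [MulAction G Y] [ContMDiffSMul 𝓘(ℝ, EG) 𝓘(ℝ, EY) 1 G Y]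

variable (EG) in
theorem isGNondegenerateAt_of_injective_restrictForm {φ : Y → ℝ} {y y₀ : Y} {g : G}
    (hφG : ∀ g : G, (fun z => φ (g • z)) =ᶠ[𝓝 y] φ)
    (hφ : ContMDiffAt 𝓘(ℝ, EY) 𝓘(ℝ, ℝ) 2 φ y) (hφg : ContMDiffAt 𝓘(ℝ, EY) 𝓘(ℝ, ℝ) 2 φ (g • y))
    (hc : IsCritical EY φ y) (hFred : (hessian (E := EY) φ y).IsFredholm)
    (hg : g • y ∈ (chartAt EY y₀).source)
    [FiniteDimensional ℝ (orbitTangent (E := EY) G EG y₀)]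
    (hrank : (Module.finrank ℝ (orbitTangent (E := EY) G EG y₀) : Cardinal) ≤
      Module.rank ℝ (orbitTangent (E := EY) G EG y))
    (hinj : Function.Injective (restrictForm
      (fderiv ℝ (fderiv ℝ fun u => φ ((chartAt EY y₀).symm u)) (chartAt EY y₀ (g • y)))
      (orbitTangent (E := EY) G EG y₀)ᗮ)) :
    IsGNondegenerateAt G EG EY φ y := by
  obtain ⟨T, hT⟩ := exists_hessian_eq_fderiv_fderiv_diffeomorph
    (s := .smul 𝓘(ℝ, EG) 𝓘(ℝ, EY) 1 g) (hφG g) hφg hc hg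
  exact isGNondegenerateAt_of_finrank_ker_le_rank EG hφG hφ hc hFred
    ((Nat.cast_le.2 (finrank_ker_le_of_restrictForm T hT hinj)).trans hrank)

variable {EX : Type*} [NormedAddCommGroup EX] {X : Type*} [TopologicalSpace X] [ChartedSpace EX X]
  {f : X × Y → ℝ} {x₀ : X} {y₀ : Y}

variable (EG) in
theorem degenerate_sliceFamily_of_smul_eq {x : X} {y : Y} {g : G}
    (hφG : ∀ g : G, (fun z => f (x, g • z)) =ᶠ[𝓝 y] fun z => f (x, z))
    (hf : ContMDiffAt 𝓘(ℝ, EY) 𝓘(ℝ, ℝ) 2 (fun z => f (x, z)) y)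
    (hfg : ContMDiffAt 𝓘(ℝ, EY) 𝓘(ℝ, ℝ) 2 (fun z => f (x, z)) (g • y))
    (hc : IsCritical EY (fun z => f (x, z)) y)
    (hFred : (hessian (E := EY) (fun z => f (x, z)) y).IsFredholm)
    [FiniteDimensional ℝ (orbitTangent (E := EY) G EG y₀)]
    (hrank : (Module.finrank ℝ (orbitTangent (E := EY) G EG y₀) : Cardinal) ≤
      Module.rank ℝ (orbitTangent (E := EY) G EG y))
    (hdeg : ¬ IsGNondegenerateAt G EG EY (fun z => f (x, z)) y)
    {w : (orbitTangent (E := EY) G EG y₀)ᗮ} (hx : x ∈ (chartAt EX x₀).source)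
    (hw : chartAt EY y₀ y₀ + w ∈ (chartAt EY y₀).target)
    (hgw : g • y = (chartAt EY y₀).symm (chartAt EY y₀ y₀ + w)) :
    fderivRight (sliceFamily f x₀ y₀ (orbitTangent (E := EY) G EG y₀)ᗮ) (chartAt EX x₀ x, w) = 0 ∧
      ¬ Function.Injective (fderivRight (fderivRight
        (sliceFamily f x₀ y₀ (orbitTangent (E := EY) G EG y₀)ᗮ)) (chartAt EX x₀ x, w)) := by
  have hcg : IsCritical EY (fun z => f (x, z)) (g • y) :=
    hc.diffeomorph (s := .smul 𝓘(ℝ, EG) 𝓘(ℝ, EY) 1 g) (hφG g) (hfg.mdifferentiableAt (by simp))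
  have hg : g • y ∈ (chartAt EY y₀).source := hgw ▸ (chartAt EY y₀).map_target hw
  have hchart : chartAt EY y₀ (g • y) = chartAt EY y₀ y₀ + w := by
    rw [hgw, (chartAt EY y₀).right_inv hw]
  refine ⟨fderivRight_sliceFamily_eq_zero hx hw (hgw ▸ hfg) (hgw ▸ hcg), fun hinj => hdeg ?_⟩
  rw [fderivRight_fderivRight_sliceFamily hx hw (hgw ▸ hfg) (hgw ▸ hcg), ← hchart] at hinj
  exact isGNondegenerateAt_of_injective_restrictForm EG hφG hf hfg hc hFred hg hrank hinj

variable [NormedSpace ℝ EX] [CompleteSpace EX] [IsManifold 𝓘(ℝ, EX) 2 X]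

theorem hasNowhereDenseProjAt_degenerate_sliceFamily {D : Submodule ℝ EY}
    [D.HasOrthogonalProjection]
    (hf : ContMDiffAt (𝓘(ℝ, EX).prod 𝓘(ℝ, EY)) 𝓘(ℝ, ℝ) 2 f (x₀, y₀))
    (hc : IsCritical EY (fun y => f (x₀, y)) y₀)
    (hFred : (hessian (E := EY) (fun y => f (x₀, y)) y₀).IsFredholm)
    (hD : D ≤ (hessian (fun y => f (x₀, y)) y₀).ker)
    (hT : ∀ v : EY, hessian (fun y => f (x₀, y)) y₀ v = 0 → v ∉ D →
      ∃ w : EX, mixedDerivative f x₀ y₀ v w ≠ 0) :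
    HasNowhereDenseProjAt {q | fderivRight (sliceFamily (EX := EX) f x₀ y₀ Dᗮ) q = 0 ∧
      ¬ Function.Injective (fderivRight (fderivRight (sliceFamily f x₀ y₀ Dᗮ)) q)}
      (chartAt EX x₀ x₀, 0) := by
  have hfx := contMDiffAt_curry_right hf
  have hsymm := hessian_symm hfx
  have hself := fderivRight_fderivRight_sliceFamily_self (EX := EX) (W := Dᗮ) hfx hc
  refine hasNowhereDenseProjAt_degenerateCriticalPoints
    (contDiffAt_sliceFamily (mem_chart_target EX x₀) (by simp) (by simpa using hf))
    (fderivRight_sliceFamily_eq_zero (mem_chart_source EX x₀) (by simp) (by simpa using hfx)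
      (by simpa using hc)) ?_ fun v hv hv0 => ?_
  · rw [hself]
    exact isFredholm_restrictForm_orthogonal hsymm hD hFred
  · rw [hself] at hv
    have hvD : (v : EY) ∉ D := fun h =>
      hv0 (Subtype.ext (inner_self_eq_zero.1 (v.2 v h)))
    obtain ⟨w, hw⟩ := hT v (apply_eq_zero_of_restrictForm_orthogonal hsymm hD hv) hvD
    exact ⟨w, by rwa [fderiv_fderivRight_sliceFamily_eq_mixedDerivative hf]⟩

variable [CompleteSpace EG]

theorem hasNowhereDenseProjAt_gDegenerate {A : Set (X × Y)} (hA : IsOpen A)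
    (hAG : ∀ (x : X) (y : Y) (g : G), (x, y) ∈ A → (x, g • y) ∈ A)
    (hf : ∀ z ∈ A, ContMDiffAt (𝓘(ℝ, EX).prod 𝓘(ℝ, EY)) 𝓘(ℝ, ℝ) 2 f z)
    (hfG : ∀ (x : X) (y : Y) (g : G), (x, y) ∈ A → f (x, g • y) = f (x, y))
    (hFredholm : ∀ (x : X) (y : Y), (x, y) ∈ A → IsCritical EY (fun y => f (x, y)) y →
      (hessian (E := EY) (fun y => f (x, y)) y).IsFredholm)
    (h₀ : (x₀, y₀) ∈ A) (hc₀ : IsCritical EY (fun y => f (x₀, y)) y₀)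
    (hT : ∀ v : EY, hessian (fun y => f (x₀, y)) y₀ v = 0 →
      v ∉ orbitTangent (E := EY) G EG y₀ → ∃ w : EX, mixedDerivative f x₀ y₀ v w ≠ 0) :
    HasNowhereDenseProjAt {z : X × Y | z ∈ A ∧ IsCritical EY (fun y => f (z.1, y)) z.2 ∧
      ¬ IsGNondegenerateAt G EG EY (fun y => f (z.1, y)) z.2} (x₀, y₀) := by
  have hFred₀ := hFredholm x₀ y₀ h₀ hc₀
  have := hFred₀.finite_ker
  have hle := orbitTangent_le_ker_hessian EG (eventuallyEq_comp_smul hA hfG h₀)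
    (contMDiffAt_curry_right (hf _ h₀)) hc₀
  have := Submodule.finiteDimensional_of_le hle
  have : IsManifold 𝓘(ℝ, EY) 1 Y := .of_le one_le_two
  refine .of_eventually (chartAt EX x₀) (mem_chart_source EX x₀)
    (hasNowhereDenseProjAt_degenerate_sliceFamily (hf _ h₀) hc₀ hFred₀ hle hT) fun N' hN' => ?_
  obtain ⟨U, hU, V, hV, hUV⟩ := mem_nhds_prod_iff.1 hN'
  have htarget : ∀ᶠ w : (orbitTangent (E := EY) G EG y₀)ᗮ in 𝓝 0,
      chartAt EY y₀ y₀ + (w : EY) ∈ (chartAt EY y₀).target :=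
    (hasFDerivAt_const_add_subtype _ _).continuousAt.eventually_mem
      ((chartAt EY y₀).open_target.mem_nhds (by simp))
  have hslice := (eventually_exists_smul_eq_chart_symm_add EG G
    (Submodule.sup_orthogonal_of_hasOrthogonalProjection (K := orbitTangent G EG y₀))
    (inter_mem hV htarget)).and
      (eventually_finrank_orbitTangent_le_rank (E := EY) (EG := EG) (G := G) y₀)
  have hchart := ((chartAt EX x₀).continuousAt (mem_chart_source EX x₀)).eventually_mem hU
  filter_upwards [continuousAt_fst.eventually (chart_source_mem_nhds EX x₀),
    continuousAt_fst.eventually hchart, continuousAt_snd.eventually hslice]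
    with ⟨x, y⟩ hx hxU ⟨⟨g, w, ⟨hwV, hw⟩, hgw⟩, hrank⟩ ⟨hxy, hc, hdeg⟩
  exact ⟨w, degenerate_sliceFamily_of_smul_eq EG (eventuallyEq_comp_smul hA hfG hxy)
    (contMDiffAt_curry_right (hf _ hxy)) (contMDiffAt_curry_right (hf _ (hAG x y g hxy))) hc
    (hFredholm x y hxy hc) hrank hdeg hx hw hgw, hUV ⟨hxU, hwV⟩⟩

end GenericInvariant

end GMorse

end

theorem theorem2p6_general
    {EG : Type*} [NormedAddCommGroup EG] [NormedSpace ℝ EG] [CompleteSpace EG]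
    {G : Type*} [TopologicalSpace G] [ChartedSpace EG G] [Group G]
    {EX : Type*} [NormedAddCommGroup EX] [NormedSpace ℝ EX] [CompleteSpace EX]
    {X : Type*} [TopologicalSpace X] [ChartedSpace EX X] [IsManifold 𝓘(ℝ, EX) 2 X]
    [TopologicalSpace.SeparableSpace X]
    {EY : Type*} [NormedAddCommGroup EY] [InnerProductSpace ℝ EY] [CompleteSpace EY]
    {Y : Type*} [TopologicalSpace Y] [ChartedSpace EY Y] [IsManifold 𝓘(ℝ, EY) 2 Y]
    [SecondCountableTopology Y]
    [MulAction G Y] [ContMDiffSMul 𝓘(ℝ, EG) 𝓘(ℝ, EY) 1 G Y]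
    (A : Set (X × Y)) (hA : IsOpen A)
    (hAG : ∀ (x : X) (y : Y) (g : G), (x, y) ∈ A → (x, g • y) ∈ A)
    (f : X × Y → ℝ)
    (hf : ContMDiffOn (𝓘(ℝ, EX).prod 𝓘(ℝ, EY)) 𝓘(ℝ, ℝ) 2 f A)
    (hfG : ∀ (x : X) (y : Y) (g : G), (x, y) ∈ A → f (x, g • y) = f (x, y))
    (hFredholm : ∀ (x₀ : X) (y₀ : Y), (x₀, y₀) ∈ A →
      GMorse.IsCritical EY (fun y => f (x₀, y)) y₀ →
      (GMorse.hessian (E := EY) (fun y => f (x₀, y)) y₀).IsFredholm)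
    (hTransverse : ∀ (x₀ : X) (y₀ : Y), (x₀, y₀) ∈ A →
      GMorse.IsCritical EY (fun y => f (x₀, y)) y₀ →
      ∀ v : EY, GMorse.hessian (E := EY) (fun y => f (x₀, y)) y₀ v = 0 →
        v ∉ GMorse.orbitTangent (E := EY) G EG y₀ →
        ∃ w : EX, GMorse.mixedDerivative f x₀ y₀ v w ≠ 0) :
    {x : (Prod.fst '' A : Set X) |
        GMorse.IsGMorseOn G EG EY (fun y => f ((x : X), y)) {y : Y | ((x : X), y) ∈ A}} ∈
      residual (Prod.fst '' A : Set X) := by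
  have hres : ∀ᶠ x in residual X, ∀ y, (x, y) ∉ {z : X × Y | z ∈ A ∧
      GMorse.IsCritical EY (fun y => f (z.1, y)) z.2 ∧
      ¬ GMorse.IsGNondegenerateAt G EG EY (fun y => f (z.1, y)) z.2} :=
    GMorse.eventually_residual_forall_notMem EX fun z hz =>
      GMorse.hasNowhereDenseProjAt_gDegenerate hA hAG (fun z hz => hf.contMDiffAt (hA.mem_nhds hz))
        hfG hFredholm hz.1 hz.2.1 (hTransverse z.1 z.2 hz.1 hz.2.1)
  have hopen : IsOpen (Prod.fst '' A) := isOpenMap_fst A hA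
  filter_upwards [tendsto_residual_of_isOpenMap continuous_subtype_val
    hopen.isOpenMap_subtype_val hres] with x hx y hy hc
  exact not_not.1 fun hdeg => hx y ⟨hy, hc, hdeg⟩

theorem theorem2p6
    -- a finite-dimensional Lie group
    {EG : Type*} [NormedAddCommGroup EG] [NormedSpace ℝ EG] [FiniteDimensional ℝ EG]
    {G : Type*} [TopologicalSpace G] [ChartedSpace EG G] [Group G] [LieGroup 𝓘(ℝ, EG) ∞ G]
    -- a separable Banach manifold and a second countable Hilbert manifold, both of class `C^k`
    (k : WithTop ℕ∞) (hk : 2 ≤ k)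
    {EX : Type*} [NormedAddCommGroup EX] [NormedSpace ℝ EX] [CompleteSpace EX]
    {X : Type*} [TopologicalSpace X] [ChartedSpace EX X] [IsManifold 𝓘(ℝ, EX) k X]
    [TopologicalSpace.SeparableSpace X]
    {EY : Type*} [NormedAddCommGroup EY] [InnerProductSpace ℝ EY] [CompleteSpace EY]
    {Y : Type*} [TopologicalSpace Y] [ChartedSpace EY Y] [IsManifold 𝓘(ℝ, EY) k Y]
    [SecondCountableTopology Y]
    -- an action of class `C^1`, all of whose orbits have the same dimension
    [MulAction G Y] [ContMDiffSMul 𝓘(ℝ, EG) 𝓘(ℝ, EY) 1 G Y]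
    (hdim : ∀ y y' : Y, Module.finrank ℝ (GMorse.orbitTangent (E := EY) G EG y) =
      Module.finrank ℝ (GMorse.orbitTangent (E := EY) G EG y'))
    -- the invariant open domain and the invariant function of class `C^k`
    (A : Set (X × Y)) (hA : IsOpen A)
    (hAG : ∀ (x : X) (y : Y) (g : G), (x, y) ∈ A → (x, g • y) ∈ A)
    (f : X × Y → ℝ)
    (hf : ContMDiffOn (𝓘(ℝ, EX).prod 𝓘(ℝ, EY)) 𝓘(ℝ, ℝ) k f A)
    (hfG : ∀ (x : X) (y : Y) (g : G), (x, y) ∈ A → f (x, g • y) = f (x, y))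
    -- (a) Hessians at critical points are Fredholm
    (hFredholm : ∀ (x₀ : X) (y₀ : Y), (x₀, y₀) ∈ A →
      GMorse.IsCritical EY (fun y => f (x₀, y)) y₀ →
      (GMorse.hessian (E := EY) (fun y => f (x₀, y)) y₀).IsFredholm)
    -- (b) the transversality condition
    (hTransverse : ∀ (x₀ : X) (y₀ : Y), (x₀, y₀) ∈ A →
      GMorse.IsCritical EY (fun y => f (x₀, y)) y₀ →
      ∀ v : EY, GMorse.hessian (E := EY) (fun y => f (x₀, y)) y₀ v = 0 →
        v ∉ GMorse.orbitTangent (E := EY) G EG y₀ →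
        ∃ w : EX, GMorse.mixedDerivative f x₀ y₀ v w ≠ 0) :
    {x : (Prod.fst '' A : Set X) |
        GMorse.IsGMorseOn G EG EY (fun y => f ((x : X), y)) {y : Y | ((x : X), y) ∈ A}} ∈
      residual (Prod.fst '' A : Set X) := by
  have : IsManifold 𝓘(ℝ, EX) 2 X := .of_le hk
  have : IsManifold 𝓘(ℝ, EY) 2 Y := .of_le hk
  have : CompleteSpace EG := FiniteDimensional.complete ℝ EG
  exact theorem2p6_general A hA hAG f (hf.of_le hk) hfG hFredholm hTransverse
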